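/- Let $G$ be a finite group and let $n\ge 3$. Write $[x,y]=x^{-1}y^{-1}xy$ and $x^y=y^{-1}xy$, and let $G'$ be the commutator subgroup of $G$. Put \[K(G,n)=\{(g_1,\dots,g_n)\in G^n : g_1\cdots g_n\in G'\}.\] For a free presentation $G=F/N$, with $F$ a free group of finite rank, put $\tilde K(G,n)=K(F,n)/K(N,n)^{F^n}$, where $K(N,n)^{F^n}$ is the normal closure of $K(N,n)$ in $F^n$. Let $G^*$ be a copy of $G$ and let $\nu(G)$ be the quotient of the free product $G\star G^*$ by the relations $[x,y^*]^z=[x^z,(y^z)^*]=[x,y^*]^{z^*}$ for all $x,y,z\in G$; let $\nabla(G)=\langle [x,x^*]: x\in G\rangle\le\nu(G)$ and $\tau(G)=\nu(G)/\nabla(G)$. The non-abelian exterior square $G\wedge G$ is the kernel of the homomorphism $\tau(G)\to G\times G$ with $g\mapsto(g,1)$, $g^*\mapsto (1,g)$; write $g\wedge h=[g,h^*]\in G\wedge G$, and let $G$ act on $G\wedge G$ by conjugation in $\tau(G)$, so that $(x\wedge y)^z=x^z\wedge y^z$. A Schur cover of $G$ is a group $H$ with a surjective homomorphism $\pi\colon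 H\to G$ whose kernel $M$ lies in $H'\cap Z(H)$ and is isomorphic to $H^2(G,\mathbb{C}^\times)$ (trivial action). For $g,h\in G^{n-1}$ define \[\mu(g,h)=(g_1h_1)\cdots(g_{n-1}h_{n-1})\,(g_1\cdots g_{n-1})^{-1}(h_1\cdots h_{n-1})^{-1}\in G',\] and for $c\in G'$ or $c\in G\wedge G$ put $c^h=c^{(h_1\cdots h_{n-1})^{-1}}$. A group of the form $B.A$ is the set of pairs $(g;c)$ with $g\in B$, $c\in A$ under a multiplication for which $\{(1;c):c\in A\}$ is a normal subgroup isomorphic to $A$ via $c\mapsto(1;c)$, with quotient $B$ via $(g;c)\mapsto g$. The following hold. a) $K(G,n)\cong G^{n-1}.G'$, where \[(g;c)(h;d)=(gh;\ \mu(g,h)\,c^h\,d).\] Moreover $\mu(g,h)(c^g)^h=c^{gh}\mu(g,h)$ for all $g,h\in G^{n-1}$ and $c\in G'$. b) Let $\pi\colon H\to G$ be a Schur cover of $G$. There is an isomorphism $\theta\colon G\wedge G\to H'$ with $\theta(\pi(x)\wedge\pi(y))=[x,y]$ and $\theta(c^{\pi(x)})=\theta(c)^x$ for all $x,y\in H$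 and $c\in G\wedge G$. With $\mu$ defined for $H$ as above, $\mu(g',h')\in H'$ depends only on the images $g,h\in G^{n-1}$ of $g',h'\in H^{n-1}$, and for every free presentation of $G$ as above we have $\tilde K(G,n)\cong G^{n-1}.(G\wedge G)$, where \[(g;c)(h;d)=(gh;\ \theta^{-1}(\mu(g',h'))\,c^h\,d)\] for any $g',h'\in H^{n-1}$ that map onto $g,h$. c) For every free presentation $G=F/N$ as above there is a central extension \[1\to H_2(G,\mathbb{Z})\to\tilde K(G,n)\to K(G,n)\to 1,\] in which $\tilde K(G,n)\to K(G,n)$ is the map induced by $F\to G$. -/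

import Mathlib

universe u v

namespace LiedtkeK

/-! ### Conventions: `x ^ y = y⁻¹ x y` and `[x, y] = x⁻¹ y⁻¹ x y` -/

/-- The conjugate `x ^ y = y⁻¹ x y`. -/
def rconj {G : Type*} [Group G] (x y : G) : G := y⁻¹ * x * y

/-- The commutator `[x, y] = x⁻¹ y⁻¹ x y`. -/
def rcomm {G : Type*} [Group G] (x y : G) : G := x⁻¹ * y⁻¹ * x * y

/-- The element `c ^ x = x⁻¹ c x` of a normal subgroup `N`, for `c ∈ N`. -/
def conjIn {G : Type*} [Group G] (N : Subgroup G) [N.Normal] (c : N) (x : G) : N :=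
  ⟨rconj (c : G) x, by
    simpa [rconj] using Subgroup.Normal.conj_mem (inferInstance : N.Normal) (c : G) c.2 x⁻¹⟩

/-- The ordered product `g₁ g₂ ⋯ gₘ` of the entries of a tuple. -/
def tupleProd {G : Type*} [Group G] {m : ℕ} (g : Fin m → G) : G := (List.ofFn g).prod

theorem abelianization_tupleProd {G : Type*} [Group G] {m : ℕ} (g : Fin m → G) :
    Abelianization.of (tupleProd g) = ∏ i, Abelianization.of (g i) := by
  simp only [tupleProd, map_list_prod, List.map_ofFn, List.prod_ofFn, Function.comp_apply]

theorem mem_commutator_iff {G : Type*} [Group G] (x : G) :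
    x ∈ commutator G ↔ Abelianization.of x = 1 := by
  rw [← Abelianization.ker_of, MonoidHom.mem_ker]

/-! ### The groups `K(G, n)` and `K̃(G, n)` -/

/-- `K(G, n) = {(g₁, …, gₙ) ∈ Gⁿ : g₁ ⋯ gₙ ∈ G'}`. -/
def K (G : Type*) [Group G] (n : ℕ) : Subgroup (Fin n → G) where
  carrier := {g | tupleProd g ∈ commutator G}
  one_mem' := by
    simp [mem_commutator_iff, abelianization_tupleProd]
  mul_mem' := by
    intro a b ha hb
    simp only [Set.mem_ofPred_eq, mem_commutator_iff, abelianization_tupleProd] at ha hb ⊢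
    simp [Finset.prod_mul_distrib, ha, hb]
  inv_mem' := by
    intro a ha
    simp only [Set.mem_ofPred_eq, mem_commutator_iff, abelianization_tupleProd] at ha ⊢
    simp [ha]

theorem mem_K {G : Type*} [Group G] {n : ℕ} (g : Fin n → G) :
    g ∈ K G n ↔ tupleProd g ∈ commutator G := Iff.rfl

/-- A homomorphism `f : G → H` applied to every coordinate, `Gⁿ → Hⁿ`. -/
def powMap {G H : Type*} [Group G] [Group H] (f : G →* H) (n : ℕ) :
    (Fin n → G) →* (Fin n → H) := f.compLeft (Fin n)

theorem powMap_mem_K {G H : Type*} [Group G] [Group H] (f : G →* H) (n : ℕ)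
    {g : Fin n → G} (hg : g ∈ K G n) : powMap f n g ∈ K H n := by
  rw [mem_K, mem_commutator_iff] at hg ⊢
  have h : tupleProd (powMap f n g) = f (tupleProd g) := by
    simp only [tupleProd, map_list_prod, List.map_ofFn]; rfl
  rw [h, ← Abelianization.map_of, hg, map_one]

/-- The map `K(G, n) → K(H, n)` induced by a homomorphism `f : G → H`. -/
def KMap {G H : Type*} [Group G] [Group H] (f : G →* H) (n : ℕ) : K G n →* K H n :=
  ((powMap f n).comp (K G n).subtype).codRestrict (K H n) fun g => powMap_mem_K f n g.2

/-- For a subgroup `N ≤ F`, the group `K(N, n) ≤ Nⁿ` regarded as a subgroup of `Fⁿ`. -/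
def KIn {F : Type*} [Group F] (N : Subgroup F) (n : ℕ) : Subgroup (Fin n → F) :=
  (K N n).map (powMap N.subtype n)

/-- The normal closure `K(N, n)^{Fⁿ}` of `K(N, n)` in `Fⁿ`, where `N = ker p`, regarded as a
subgroup of `K(F, n)` (in which it is contained). -/
def KRel {F G : Type*} [Group F] [Group G] (p : F →* G) (n : ℕ) : Subgroup (K F n) :=
  (Subgroup.normalClosure (KIn p.ker n : Set (Fin n → F))).subgroupOf (K F n)

instance {F G : Type*} [Group F] [Group G] (p : F →* G) (n : ℕ) : (KRel p n).Normal := by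
  unfold KRel; infer_instance

instance K_normal (G : Type*) [Group G] (n : ℕ) : (K G n).Normal where
  conj_mem := by
    intro a ha b
    simp only [mem_K, mem_commutator_iff, abelianization_tupleProd] at ha ⊢
    simp [ha]

/-- `K(N, n)^{Fⁿ}` is indeed contained in `K(F, n)`, so nothing is lost in `KRel`. -/
theorem normalClosure_KIn_le {F G : Type*} [Group F] [Group G] (p : F →* G) (n : ℕ) :
    Subgroup.normalClosure (KIn p.ker n : Set (Fin n → F)) ≤ K F n := by
  refine Subgroup.normalClosure_le_normal ?_
  rintro _ ⟨x, hx, rfl⟩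
  exact powMap_mem_K _ n hx

/-- `K̃(G, n) = K(F, n) / K(N, n)^{Fⁿ}`, computed from a free presentation `p : F → G` of `G` with
kernel `N`. -/
abbrev KTilde {F G : Type*} [Group F] [Group G] (p : F →* G) (n : ℕ) : Type _ :=
  K F n ⧸ KRel p n

/-! ### The group `τ(G)` and the non-abelian exterior square -/

open Monoid.Coprod in
/-- The defining relators of `ν(G)` in the free product `G ⋆ G*`, the first factor being `G` and
the second one its copy `G*`. -/
def nuRels (G : Type*) [Group G] : Set (Monoid.Coprod G G) :=
  {r | ∃ x y z : G,
    r = rconj (rcomm (inl x) (inr y)) (inl z) * (rcomm (inl (rconj x z)) (inr (rconj y z)))⁻¹ ∨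
    r = rconj (rcomm (inl x) (inr y)) (inr z) * (rcomm (inl (rconj x z)) (inr (rconj y z)))⁻¹}

/-- The group `ν(G)`. -/
abbrev Nu (G : Type*) [Group G] : Type _ :=
  Monoid.Coprod G G ⧸ Subgroup.normalClosure (nuRels G)

/-- The map `G → ν(G)` onto the first copy of `G`. -/
def nuL (G : Type*) [Group G] : G →* Nu G := (QuotientGroup.mk' _).comp Monoid.Coprod.inl

/-- The map `G → ν(G)`, `g ↦ g*`. -/
def nuR (G : Type*) [Group G] : G →* Nu G := (QuotientGroup.mk' _).comp Monoid.Coprod.inr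

/-- `∇(G) = ⟨[x, x*] : x ∈ G⟩ ≤ ν(G)`. -/
def nabla (G : Type*) [Group G] : Subgroup (Nu G) :=
  Subgroup.closure (Set.range fun x : G => rcomm (nuL G x) (nuR G x))

theorem nu_rel_left {G : Type*} [Group G] (x y z : G) :
    rconj (rcomm (nuL G x) (nuR G y)) (nuL G z) =
      rcomm (nuL G (rconj x z)) (nuR G (rconj y z)) := by
  have h := (QuotientGroup.eq_one_iff _).2
    (Subgroup.subset_normalClosure (s := nuRels G) ⟨x, y, z, Or.inl rfl⟩)
  exact mul_inv_eq_one.1 h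

theorem nu_rel_right {G : Type*} [Group G] (x y z : G) :
    rconj (rcomm (nuL G x) (nuR G y)) (nuR G z) =
      rcomm (nuL G (rconj x z)) (nuR G (rconj y z)) := by
  have h := (QuotientGroup.eq_one_iff _).2
    (Subgroup.subset_normalClosure (s := nuRels G) ⟨x, y, z, Or.inr rfl⟩)
  exact mul_inv_eq_one.1 h

theorem nabla_conj_aux {G : Type*} [Group G] (w : Monoid.Coprod G G) :
    ∀ n ∈ nabla G, (w : Nu G) * n * (w : Nu G)⁻¹ ∈ nabla G := by
  have key : ∀ a : Nu G, (∀ x : G, ∃ y : G,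
      a * rcomm (nuL G x) (nuR G x) * a⁻¹ = rcomm (nuL G y) (nuR G y)) →
      ∀ n ∈ nabla G, a * n * a⁻¹ ∈ nabla G := by
    intro a ha n hn
    induction hn using Subgroup.closure_induction with
    | mem t ht =>
      obtain ⟨x, rfl⟩ := ht
      obtain ⟨y, hy⟩ := ha x
      exact hy ▸ Subgroup.subset_closure ⟨y, rfl⟩
    | one => simp [one_mem]
    | mul s t _ _ hs ht => simpa [mul_assoc] using mul_mem hs ht
    | inv s _ hs => simpa [mul_assoc] using inv_mem hs
  induction w using Monoid.Coprod.induction_on with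
  | inl z =>
    refine key _ fun x => ⟨rconj x z⁻¹, ?_⟩
    rw [← nu_rel_left]; simp only [rconj, map_inv, inv_inv]; rfl
  | inr z =>
    refine key _ fun x => ⟨rconj x z⁻¹, ?_⟩
    rw [← nu_rel_right]; simp only [rconj, map_inv, inv_inv]; rfl
  | mul a b iha ihb =>
    intro n hn
    have h := iha _ (ihb n hn)
    rw [QuotientGroup.mk_mul]
    simpa [mul_assoc] using h

instance nabla_normal (G : Type*) [Group G] : (nabla G).Normal where
  conj_mem n hn g := by
    obtain ⟨w, rfl⟩ := QuotientGroup.mk_surjective g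
    exact nabla_conj_aux w n hn

/-- The group `τ(G) = ν(G) / ∇(G)`. -/
abbrev Tau (G : Type*) [Group G] : Type _ := Nu G ⧸ nabla G

/-- The map `G → τ(G)` onto the first copy of `G`. -/
def tauL (G : Type*) [Group G] : G →* Tau G := (QuotientGroup.mk' _).comp (nuL G)

/-- The map `G → τ(G)`, `g ↦ g*`. -/
def tauR (G : Type*) [Group G] : G →* Tau G := (QuotientGroup.mk' _).comp (nuR G)

/-- The homomorphism `ν(G) → G × G` with `g ↦ (g, 1)` and `g* ↦ (1, g)`. -/
def cNu (G : Type*) [Group G] : Nu G →* G × G :=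
  QuotientGroup.lift _ (Monoid.Coprod.lift (MonoidHom.inl G G) (MonoidHom.inr G G)) (by
    refine (Subgroup.normalClosure_le_normal (N := MonoidHom.ker (Monoid.Coprod.lift (MonoidHom.inl G G) (MonoidHom.inr G G))) ?_ : _)
    rintro r ⟨x, y, z, rfl | rfl⟩ <;>
      simp [MonoidHom.mem_ker, rconj, rcomm, mul_assoc])

/-- The homomorphism `τ(G) → G × G` with `g ↦ (g, 1)` and `g* ↦ (1, g)`. -/
def cTau (G : Type*) [Group G] : Tau G →* G × G :=
  QuotientGroup.lift _ (cNu G) (by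
    refine ((Subgroup.closure_le (K := (cNu G).ker)).2 ?_ : _)
    rintro _ ⟨x, rfl⟩
    simp [MonoidHom.mem_ker, rcomm, cNu, nuL, nuR])

/-- The non-abelian exterior square `G ∧ G`, the kernel of `τ(G) → G × G`. -/
abbrev extSq (G : Type*) [Group G] : Subgroup (Tau G) := (cTau G).ker

/-- The element `g ∧ h = [g, h*]` of `G ∧ G`. -/
def wedge {G : Type*} [Group G] (g h : G) : extSq G :=
  ⟨rcomm (tauL G g) (tauR G h), by
    simp [MonoidHom.mem_ker, rcomm, cTau, cNu, tauL, tauR, nuL, nuR]⟩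

/-! ### Schur multiplier, Schur covers, `H₂(G, ℤ)` -/

/-- The Schur multiplier `M(G) = H²(G, ℂˣ)`, for the trivial action (written additively). -/
noncomputable abbrev schurMultiplier (G : Type u) [Group G] : Type u :=
  groupCohomology (Rep.trivial (ULift.{u} ℤ) G (ULift.{u} (Additive ℂˣ))) 2

/-- The integral homology group `H₂(G, ℤ)`, for the trivial action. -/
noncomputable abbrev H2Z (G : Type u) [Group G] : Type u :=
  groupHomology (Rep.trivial (ULift.{u} ℤ) G (ULift.{u} ℤ)) 2

/-- `π : H → G` exhibits `H` as a Schur cover of `G`: it is onto, and its kernel `M` lies in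
`H' ∩ Z(H)` and is isomorphic to `M(G)`. -/
structure IsSchurCover {H : Type v} {G : Type u} [Group H] [Group G] (π : H →* G) : Prop where
  surjective : Function.Surjective π
  ker_le_commutator : π.ker ≤ commutator H
  ker_le_center : π.ker ≤ Subgroup.center H
  ker_iso : Nonempty (π.ker ≃* Multiplicative (schurMultiplier G))

/-! ### Extensions `B.A` with an explicit multiplication -/

/-- The set of pairs `(g; c)` with `g ∈ B` and `c ∈ A`, carrying no group structure yet. -/
@[ext] structure PairSet (B A : Type*) where
  base : B
  fibre : A

/-- `Q ≅ B.A` with multiplication `(g; c) (h; d) = (g h; γ(g, h) c^h d)`: this multiplication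
makes the set of pairs a group, in which `A` (embedded by `c ↦ (1; c)`) is a normal subgroup with
quotient `B` (by `(g; c) ↦ g`), and this group is isomorphic to `Q`. -/
def IsoExplicitExtension (Q B A : Type*) [Group Q] [Group B] [Group A]
    (γ : B → B → A) (act : A → B → A) : Prop :=
  ∃ _ : Group (PairSet B A),
    (∀ (g h : B) (c d : A),
      (⟨g, c⟩ * ⟨h, d⟩ : PairSet B A) = ⟨g * h, γ g h * act c h * d⟩) ∧
    (∃ S : GroupExtension A (PairSet B A) B,
      (∀ c, S.inl c = ⟨1, c⟩) ∧ ∀ u, S.rightHom u = u.base) ∧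
    Nonempty (Q ≃* PairSet B A)

/-- `μ(g, h) = (g₁h₁) ⋯ (gₘhₘ) (g₁ ⋯ gₘ)⁻¹ (h₁ ⋯ hₘ)⁻¹`, an element of `G'`. -/
def mu {G : Type*} [Group G] {m : ℕ} (g h : Fin m → G) : commutator G :=
  ⟨tupleProd (g * h) * (tupleProd g)⁻¹ * (tupleProd h)⁻¹, by
    rw [mem_commutator_iff]
    simp [abelianization_tupleProd, Finset.prod_mul_distrib]⟩

/-- `c ^ h = c ^ ((h₁ ⋯ hₘ)⁻¹)` for `c ∈ G'` and `h ∈ Gᵐ`. -/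
def tconj {G : Type*} [Group G] {m : ℕ} (c : commutator G) (h : Fin m → G) : commutator G :=
  conjIn (commutator G) c (tupleProd h)⁻¹

/-- The action of `G` on `G ∧ G` with `(x ∧ y) ^ z = x ^ z ∧ y ^ z`, that is, conjugation in
`τ(G)` by the first copy of `G`. -/
def extAct {G : Type*} [Group G] (c : extSq G) (z : G) : extSq G :=
  conjIn (extSq G) c (tauL G z)

theorem extAct_wedge {G : Type*} [Group G] (x y z : G) :
    extAct (wedge x y) z = wedge (rconj x z) (rconj y z) :=
  Subtype.ext (congrArg (QuotientGroup.mk' (nabla G)) (nu_rel_left x y z))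

/-- `c ^ h = c ^ ((h₁ ⋯ hₘ)⁻¹)` for `c ∈ G ∧ G` and `h ∈ Gᵐ`. -/
def extTconj {G : Type*} [Group G] {m : ℕ} (c : extSq G) (h : Fin m → G) : extSq G :=
  extAct c (tupleProd h)⁻¹

end LiedtkeK

namespace LiedtkeK

open scoped commutatorElement IsMulCommutative

/-! For a), a tuple in `K G n` is determined by its first `n - 1` entries and its total product, and
these may be any element of `G^{n-1}` and any element of `G'`. Multiplying tuples in these
coordinates gives the stated formula (`mu_mul_tconj_mul`).

Let `G = F/N`. For b) and c) the key is `normalClosure_KIn`: the normal closure of `K(N, n)`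
consists of the tuples with entries in `N` and product in `[N, F]`. So a class in `K̃(G, n)` amounts
to the images in `G` of its entries together with its product modulo `[N, F]`.

For c), the kernel of `K̃(G, n) → K(G, n)` is then `(N ∩ F')/[N, F]`, which Hopf's formula
(`exists_hopf`) identifies with `H₂(G, ℤ)`. It is central because `N` is central modulo `[N, F]`.

For b), lift `F → G` to `q : F → H`. Then `q` maps `F'` onto `H'`, and the kernel on `F'` is exactly
`[N, F]` (`IsSchurCover.mem_ker_commutator`): `q` induces a surjection from `H₂(G, ℤ) = (N ∩ F')/[N,
F]` onto the kernel of `H → G`, and that kernel has the order of `H²(G, ℂˣ)`, which is at least the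
order of the finite group `H₂(G, ℤ)`. Products in `F'/[N, F]` may therefore be read in `H'`, and the
computation of a) applies in `H`.

The isomorphism of `G ∧ G` with `H'` is the commutator pairing of `H`. It is injective because `G ∧
G` embeds in some central extension `E` of `G` with commutators given by wedges (`exists_wedgeExt`):
elements of `F'` that die in `H` lie in `[N, F]`, hence die in `E`. -/

theorem tupleProd_eq_init_mul {G : Type*} [Group G] {m : ℕ} (x : Fin (m + 1) → G) :
    tupleProd x = tupleProd (Fin.init x) * x (Fin.last m) := by
  rw [tupleProd, List.ofFn_succ', List.prod_concat]
  rfl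

theorem tupleProd_powMap {G H : Type*} [Group G] [Group H] (f : G →* H) {n : ℕ} (g : Fin n → G) :
    tupleProd (powMap f n g) = f (tupleProd g) := by
  simp only [tupleProd, map_list_prod, List.map_ofFn]; rfl

@[simp] theorem tupleProd_one {G : Type*} [Group G] {m : ℕ} : tupleProd (1 : Fin m → G) = 1 := by
  induction m with
  | zero => simp [tupleProd]
  | succ m ih => rw [tupleProd_eq_init_mul]; exact (mul_one _).trans ih

/-- Multiplying a tuple by central entries multiplies its product by theirs. -/
theorem tupleProd_mul_of_mem_center {G : Type*} [Group G] {m : ℕ} (g z : Fin m → G)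
    (hz : ∀ i, z i ∈ Subgroup.center G) :
    tupleProd (g * z) = tupleProd g * tupleProd z ∧ tupleProd z ∈ Subgroup.center G := by
  induction m with
  | zero => simp [tupleProd, one_mem]
  | succ m ih =>
    obtain ⟨h₁, h₂⟩ := ih (Fin.init g) (Fin.init z) fun i => hz _
    rw [tupleProd_eq_init_mul, tupleProd_eq_init_mul g, tupleProd_eq_init_mul z]
    refine ⟨?_, mul_mem h₂ (hz _)⟩
    have h₃ : Fin.init (g * z) = Fin.init g * Fin.init z := rfl
    rw [h₃, h₁, Pi.mul_apply]
    simp only [mul_assoc]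
    rw [← mul_assoc (tupleProd (Fin.init z)), ← Subgroup.mem_center_iff.1 h₂ (g (Fin.last m)),
      mul_assoc]

/-! ### Explicit extensions and the structure of `K(G, n)` -/

/-- An explicit multiplication on pairs which comes from a surjection of groups. -/
theorem isoExplicitExtension_of_surjective {P Q B A : Type*} [Group P] [Group Q] [Group B]
    [Group A] {γ : B → B → A} {act : A → B → A} (f : P →* Q) (hf : Function.Surjective f)
    (Ψ : P → PairSet B A) (hΨ : Function.Surjective Ψ)
    (hmul : ∀ x y, Ψ (x * y) = ⟨(Ψ x).base * (Ψ y).base,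
      γ (Ψ x).base (Ψ y).base * act (Ψ x).fibre (Ψ y).base * (Ψ y).fibre⟩)
    (hγ : ∀ g, γ g 1 = 1) (hact : ∀ c, act c 1 = c)
    (hker : ∀ x, Ψ x = ⟨1, 1⟩ ↔ f x = 1) :
    IsoExplicitExtension Q B A γ act := by
  -- `Ψ` is not yet a homomorphism, so its fibres are compared by hand: `hmul`, `hγ` and `hact`
  -- carry `hker` from the fibre over the identity to all fibres.
  have key : ∀ x y, Ψ x = Ψ y ↔ f x = f y := by
    intro x y
    obtain ⟨k, rfl⟩ : ∃ k, y = x * k := ⟨x⁻¹ * y, by simp⟩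
    rw [map_mul, left_eq_mul, ← hker]
    constructor
    · intro h
      have h₀ := hmul x k
      rw [← h, PairSet.ext_iff] at h₀
      obtain ⟨h₁, h₂⟩ := h₀
      simp only [left_eq_mul] at h₁
      simp only [h₁, hγ, hact, one_mul, left_eq_mul] at h₂
      exact PairSet.ext h₁ h₂
    · intro h
      rw [hmul, h]
      ext <;> simp [hγ, hact]
  choose s hs using hΨ
  let e : PairSet B A ≃ Q := Equiv.ofBijective (fun u => f (s u)) <| by
    constructor
    · intro u v h
      rw [← hs u, ← hs v]
      exact (key _ _).2 h
    · intro q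
      obtain ⟨x, rfl⟩ := hf q
      exact ⟨Ψ x, (key _ _).1 (hs _)⟩
  have he : ∀ x, e (Ψ x) = f x := fun x => (key _ _).1 (hs _)
  -- The group axioms are transported along the bijection `e`, so no cocycle identity has to be
  -- checked for `γ` and `act`.
  let _ : Group (PairSet B A) := e.group
  have hm : ∀ u v : PairSet B A,
      u * v = ⟨u.base * v.base, γ u.base v.base * act u.fibre v.base * v.fibre⟩ := by
    intro u v
    have : u * v = e.symm (e u * e v) := rfl
    rw [this, Equiv.symm_apply_eq, ← hs u, ← hs v, ← hmul, he, he, he, map_mul]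
  have h1 : (1 : PairSet B A) = ⟨1, 1⟩ := by
    have : (1 : PairSet B A) = e.symm 1 := rfl
    rw [this, Equiv.symm_apply_eq, ← (hker 1).2 (map_one f), he, map_one]
  refine ⟨inferInstance, fun g h c d => hm _ _,
    ⟨⟨⟨⟨fun c => ⟨1, c⟩, h1.symm⟩, ?_⟩, ⟨⟨fun u => u.base, by rw [h1]⟩, ?_⟩, ?_, ?_, ?_⟩, ?_, ?_⟩,
    ⟨(Equiv.mulEquiv e).symm⟩⟩
  · intro c d
    simp only [hm, hγ, hact, one_mul]
  · intro u v
    simp only [hm]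
  · intro c d h
    exact congrArg PairSet.fibre h
  · ext u
    constructor
    · rintro ⟨c, rfl⟩
      rfl
    · intro h
      exact ⟨u.fibre, PairSet.ext (Eq.symm h) rfl⟩
  · intro b
    exact ⟨⟨b, 1⟩, rfl⟩
  · intro c
    rfl
  · intro u
    rfl

/-- With `P`, `Q`, `R` the products of `g`, `h`, `g * h`, both sides reduce to `R c P⁻¹ Q⁻¹`. -/
theorem mu_mul_tconj {G : Type*} [Group G] {m : ℕ} (g h : Fin m → G) (c : commutator G) :
    mu g h * tconj (tconj c g) h = tconj c (g * h) * mu g h := by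
  apply Subtype.ext
  simp only [mu, tconj, conjIn, rconj, Subgroup.coe_mul]
  group

/-- This is where the shape of `mu` comes from: the inverse products in `mu` cancel against the
conjugating product and the initial parts of the two total products, which leaves the two last
entries. -/
theorem mu_mul_tconj_mul {G : Type*} [Group G] {m : ℕ} (x y : K G (m + 1)) :
    mu (Fin.init x.1) (Fin.init y.1) * tconj ⟨tupleProd x.1, x.2⟩ (Fin.init y.1) *
      ⟨tupleProd y.1, y.2⟩ = (⟨tupleProd (x * y).1, (x * y).2⟩ : commutator G) := by
  apply Subtype.ext
  have h : Fin.init (x.1 * y.1) = Fin.init x.1 * Fin.init y.1 := rfl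
  simp only [mu, tconj, conjIn, rconj, Subgroup.coe_mul, tupleProd_eq_init_mul, h, Pi.mul_apply]
  group

theorem mu_one_right {G : Type*} [Group G] {m : ℕ} (g : Fin m → G) : mu g 1 = 1 := by
  apply Subtype.ext
  simp [mu]

theorem tconj_one_right {G : Type*} [Group G] {m : ℕ} (c : commutator G) :
    tconj c (1 : Fin m → G) = c := by
  apply Subtype.ext
  simp [tconj, conjIn, rconj]

/-- The last entry is the one that makes the total product equal to `c`. -/
theorem snoc_mem_K {G : Type*} [Group G] {m : ℕ} (g : Fin m → G) (c : commutator G) :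
    (Fin.snoc g ((tupleProd g)⁻¹ * c) : Fin (m + 1) → G) ∈ K G (m + 1) := by
  rw [mem_K, tupleProd_eq_init_mul]
  simp

theorem isoExplicitExtension_K {G : Type*} [Group G] (m : ℕ) :
    IsoExplicitExtension (K G (m + 1)) (Fin m → G) (commutator G) mu tconj := by
  refine isoExplicitExtension_of_surjective (MonoidHom.id _) Function.surjective_id
    (fun x => ⟨Fin.init x.1, ⟨tupleProd x.1, x.2⟩⟩) ?_ ?_ mu_one_right tconj_one_right ?_
  · rintro ⟨g, c⟩
    refine ⟨⟨_, snoc_mem_K g c⟩, PairSet.ext ?_ (Subtype.ext ?_)⟩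
    · simp
    · change tupleProd (Fin.snoc _ _ : Fin (m + 1) → G) = c
      rw [tupleProd_eq_init_mul]; simp
  · intro x y
    rw [mu_mul_tconj_mul]
    rfl
  · intro x
    simp only [PairSet.ext_iff, MonoidHom.id_apply]
    constructor
    · rintro ⟨h₁, h₂⟩
      have h₂ : tupleProd x.1 = 1 := congrArg Subtype.val h₂
      rw [tupleProd_eq_init_mul, h₁, tupleProd_one, one_mul] at h₂
      apply Subtype.ext
      funext i
      induction i using Fin.lastCases with
      | last => exact h₂
      | cast i => exact congrFun h₁ i
    · rintro rfl
      exact ⟨rfl, Subtype.ext tupleProd_one⟩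

/-! ### The normal closure of `K(N, n)` in `Fⁿ` -/

/-- The image of `ker p` in `F ⧸ [ker p, F]` is central. -/
theorem mk_mem_center {F G : Type*} [Group F] [Group G] (p : F →* G) {a : F} (ha : a ∈ p.ker) :
    (QuotientGroup.mk' ⁅p.ker, (⊤ : Subgroup F)⁆ a) ∈
      Subgroup.center (F ⧸ ⁅p.ker, (⊤ : Subgroup F)⁆) := by
  rw [Subgroup.mem_center_iff]
  intro g
  obtain ⟨f, rfl⟩ := QuotientGroup.mk'_surjective _ g
  have h : QuotientGroup.mk' ⁅p.ker, (⊤ : Subgroup F)⁆ ⁅a, f⁆ = 1 :=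
    (QuotientGroup.eq_one_iff _).2 (Subgroup.commutator_mem_commutator ha trivial)
  rw [map_commutatorElement, commutatorElement_eq_one_iff_mul_comm] at h
  exact h.symm

/-- The product of a tuple with entries in `ker p`, modulo `[ker p, F]`, is multiplicative. -/
theorem mk_tupleProd_mul {F G : Type*} [Group F] [Group G] (p : F →* G) {n : ℕ}
    (x y : Fin n → F) (hy : ∀ i, p (y i) = 1) :
    (QuotientGroup.mk' ⁅p.ker, (⊤ : Subgroup F)⁆) (tupleProd (x * y)) =
      (QuotientGroup.mk' ⁅p.ker, (⊤ : Subgroup F)⁆) (tupleProd x) *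
        (QuotientGroup.mk' ⁅p.ker, (⊤ : Subgroup F)⁆) (tupleProd y) := by
  simp only [← tupleProd_powMap, map_mul]
  exact (tupleProd_mul_of_mem_center _ _ fun i => mk_mem_center p (hy i)).1

/-- The tuples with entries in `ker p` whose product lies in `[ker p, F]`. -/
def prodInCommutator {F G : Type*} [Group F] [Group G] (p : F →* G) (n : ℕ) :
    Subgroup (Fin n → F) where
  carrier := {x | (∀ i, p (x i) = 1) ∧
    (QuotientGroup.mk' ⁅p.ker, (⊤ : Subgroup F)⁆) (tupleProd x) = 1}
  one_mem' := by simp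
  mul_mem' := by
    rintro x y ⟨hx₁, hx₂⟩ ⟨hy₁, hy₂⟩
    exact ⟨fun i => by simp [hx₁, hy₁], by rw [mk_tupleProd_mul p x y hy₁, hx₂, hy₂, one_mul]⟩
  inv_mem' := by
    rintro x ⟨hx₁, hx₂⟩
    refine ⟨fun i => by simp [hx₁], ?_⟩
    have h := mk_tupleProd_mul p x⁻¹ x hx₁
    rwa [hx₂, inv_mul_cancel, tupleProd_one, map_one, mul_one, eq_comm] at h

theorem mem_prodInCommutator {F G : Type*} [Group F] [Group G] (p : F →* G) {n : ℕ}
    (x : Fin n → F) : x ∈ prodInCommutator p n ↔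
      (∀ i, p (x i) = 1) ∧ tupleProd x ∈ ⁅p.ker, (⊤ : Subgroup F)⁆ := by
  rw [← QuotientGroup.eq_one_iff (N := ⁅p.ker, (⊤ : Subgroup F)⁆)]
  rfl

/-- Modulo `[ker p, F]` the entries are central, so conjugation leaves the tuple, and with it its
product, unchanged. -/
instance prodInCommutator_normal {F G : Type*} [Group F] [Group G] (p : F →* G) (n : ℕ) :
    (prodInCommutator p n).Normal where
  conj_mem := by
    rintro x ⟨hx₁, hx₂⟩ g
    refine ⟨fun i => by simp [hx₁], ?_⟩
    rw [← hx₂, ← tupleProd_powMap, ← tupleProd_powMap]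
    congr 1
    funext i
    have h := Subgroup.mem_center_iff.1 (mk_mem_center p (hx₁ i)) (QuotientGroup.mk' _ (g i))
    have : powMap (QuotientGroup.mk' ⁅p.ker, (⊤ : Subgroup F)⁆) n (g * x * g⁻¹) i =
      QuotientGroup.mk' _ (g i) * QuotientGroup.mk' _ (x i) * (QuotientGroup.mk' _ (g i))⁻¹ := rfl
    rw [this, h, mul_inv_cancel_right]
    rfl

theorem mem_KIn_of_tupleProd_eq_one {F : Type*} [Group F] (N : Subgroup F) {n : ℕ}
    (z : Fin n → F) (hz : ∀ i, z i ∈ N) (h : tupleProd z = 1) : z ∈ KIn N n := by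
  refine ⟨fun i => ⟨z i, hz i⟩, ?_, rfl⟩
  change tupleProd _ ∈ commutator N
  have h₁ : tupleProd (fun i => (⟨z i, hz i⟩ : N)) = 1 := by
    apply N.subtype_injective
    rw [← tupleProd_powMap, map_one, ← h]
    rfl
  rw [h₁]
  exact one_mem _

theorem mulSingle_mul_mulSingle_inv_mem_KIn {F : Type*} [Group F] (N : Subgroup F) {n : ℕ}
    (i j : Fin n) {a : F} (ha : a ∈ N) :
    Pi.mulSingle i a * Pi.mulSingle j a⁻¹ ∈ KIn N n := by
  refine ⟨Pi.mulSingle i ⟨a, ha⟩ * Pi.mulSingle j ⟨a, ha⟩⁻¹, ?_, ?_⟩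
  · change _ ∈ K N n
    rw [mem_K, mem_commutator_iff, abelianization_tupleProd]
    simp only [Pi.mul_apply, map_mul, Finset.prod_mul_distrib]
    have h (k : Fin n) (b : N) :
        ∏ l, Abelianization.of ((Pi.mulSingle k b : Fin n → N) l) = Abelianization.of b := by
      rw [Finset.prod_eq_single k (fun l _ hl => by simp [Pi.mulSingle_eq_of_ne hl]) (by simp)]
      simp
    rw [h, h, map_inv, mul_inv_cancel]
  · funext l
    have h (k : Fin n) (b : N) : ((Pi.mulSingle k b : Fin n → N) l : F) =
        (Pi.mulSingle k (b : F) : Fin n → F) l := by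
      by_cases hl : l = k
      · subst hl; simp
      · simp [Pi.mulSingle_eq_of_ne hl]
    change (((Pi.mulSingle i ⟨a, ha⟩ : Fin n → N) l * (Pi.mulSingle j ⟨a, ha⟩⁻¹ : Fin n → N) l : N) : F) = _
    rw [Subgroup.coe_mul, h, h]
    rfl

/-- One inclusion is `[N, N] ≤ [N, F]` together with normality. For the other, conjugation in one
slot produces all of `[N, F]` in the last slot, and after such a correction the product is trivial.
A second slot is needed, hence `1 ≤ m`. -/
theorem normalClosure_KIn {F G : Type*} [Group F] [Group G] (p : F →* G) {m : ℕ} (hm : 1 ≤ m) :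
    Subgroup.normalClosure (KIn p.ker (m + 1) : Set (Fin (m + 1) → F)) =
      prodInCommutator p (m + 1) := by
  set C := Subgroup.normalClosure (KIn p.ker (m + 1) : Set (Fin (m + 1) → F)) with hC
  apply le_antisymm
  · refine Subgroup.normalClosure_le_normal ?_
    rintro _ ⟨x, hx, rfl⟩
    rw [SetLike.mem_coe, mem_prodInCommutator]
    refine ⟨fun i => (x i).2, ?_⟩
    rw [tupleProd_powMap]
    have h : (commutator p.ker).map p.ker.subtype ≤ ⁅p.ker, (⊤ : Subgroup F)⁆ := by
      rw [commutator_def, Subgroup.map_commutator]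
      refine Subgroup.commutator_mono ?_ le_top
      rintro _ ⟨y, -, rfl⟩
      exact y.2
    exact h ⟨_, hx, rfl⟩
  · intro x hx
    rw [mem_prodInCommutator] at hx
    obtain ⟨hx₁, hx₂⟩ := hx
    have : Nontrivial (Fin (m + 1)) := Fin.nontrivial_iff_two_le.2 (by omega)
    obtain ⟨j, hj⟩ := exists_ne (Fin.last m)
    set i := Fin.last m
    have hcomm : ⁅p.ker, (⊤ : Subgroup F)⁆ ≤ C.comap (MonoidHom.mulSingle (fun _ => F) i) := by
      rw [Subgroup.commutator_le]
      intro a ha f _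
      -- Conjugating this tuple by `f` in slot `i` leaves slot `j` alone, so the quotient of the two
      -- is `⁅a, f⁆` in slot `i` and trivial elsewhere.
      have h₁ : Pi.mulSingle i a * Pi.mulSingle j a⁻¹ ∈ C :=
        Subgroup.subset_normalClosure (mulSingle_mul_mulSingle_inv_mem_KIn _ i j ha)
      have h₂ := mul_mem h₁ (inv_mem
        ((inferInstance : C.Normal).conj_mem _ h₁ (Pi.mulSingle i f)))
      rw [Subgroup.mem_comap]
      convert h₂ using 1
      funext l
      by_cases hl : l = i
      · subst hl
        simp [Pi.mulSingle_eq_of_ne hj.symm, commutatorElement_def, mul_assoc]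
      · simp [Pi.mulSingle_eq_of_ne hl, commutatorElement_def]
    have hz : x * Pi.mulSingle i (tupleProd x)⁻¹ ∈ C := by
      refine Subgroup.subset_normalClosure (mem_KIn_of_tupleProd_eq_one _ _ ?_ ?_)
      · intro l
        have : p (tupleProd x) = 1 :=
          (Subgroup.commutator_le_left p.ker ⊤ hx₂ : tupleProd x ∈ p.ker)
        by_cases hl : l = i
        · subst hl
          simp [MonoidHom.mem_ker, this, hx₁]
        · simp [Pi.mulSingle_eq_of_ne hl, MonoidHom.mem_ker, hx₁]
      · rw [tupleProd_eq_init_mul]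
        have : Fin.init (x * Pi.mulSingle i (tupleProd x)⁻¹) = Fin.init x := by
          funext l
          simp [Fin.init, i]
        rw [this]
        simp [i, tupleProd_eq_init_mul x]
    have h := mul_mem hz (hcomm hx₂)
    simpa [mul_assoc, ← Pi.mulSingle_mul] using h

theorem mem_KRel {F G : Type*} [Group F] [Group G] (p : F →* G) {m : ℕ} (hm : 1 ≤ m)
    (x : K F (m + 1)) : x ∈ KRel p (m + 1) ↔
      (∀ i, p (x.1 i) = 1) ∧ tupleProd x.1 ∈ ⁅p.ker, (⊤ : Subgroup F)⁆ := by
  rw [← mem_prodInCommutator, ← normalClosure_KIn p hm]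
  rfl

/-! ### Homomorphisms which agree up to central elements -/

/-- The quotient of the two maps is a homomorphism to the abelian group `Subgroup.center E`, so it
kills commutators. -/
theorem eqOn_commutator_of_mul_inv_mem_center {F E : Type*} [Group F] [Group E] (α β : F →* E)
    (h : ∀ x, α x * (β x)⁻¹ ∈ Subgroup.center E) {x : F} (hx : x ∈ commutator F) :
    α x = β x := by
  let z : F →* Subgroup.center E :=
    { toFun := fun x => ⟨α x * (β x)⁻¹, h x⟩
      map_one' := by ext; simp
      map_mul' := by
        intro x y
        ext
        have h₁ := Subgroup.mem_center_iff.1 (h y) (β x)⁻¹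
        simp only [map_mul, mul_inv_rev, Subgroup.coe_mul]
        rw [mul_assoc (α x) (α y), ← mul_assoc (α y), ← h₁, mul_assoc] }
  have hz : commutator F ≤ z.ker := by
    rw [commutator_def, Subgroup.commutator_le]
    intro a _ b _
    rw [MonoidHom.mem_ker, map_commutatorElement, commutatorElement_eq_one_iff_mul_comm]
    exact Subtype.ext (Subgroup.mem_center_iff.1 (z b).2 _)
  exact mul_inv_eq_one.1 (congrArg Subtype.val (hz hx))

theorem commutator_map_mem {F E : Type*} [Group F] [Group E] (f : F →* E) {x : F}
    (hx : x ∈ commutator F) : f x ∈ commutator E := by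
  have : (commutator F).map f ≤ commutator E := by
    rw [commutator_def, commutator_def, Subgroup.map_commutator]
    exact Subgroup.commutator_mono le_top le_top
  exact this ⟨x, hx, rfl⟩

/-- `[ker p, F]` dies in every central extension through which `p` factors. -/
theorem map_eq_one_of_mem_ker_commutator {F G H : Type*} [Group F] [Group G] [Group H]
    (p : F →* G) (q : F →* H) (hq : ∀ x, p x = 1 → q x ∈ Subgroup.center H) {x : F}
    (hx : x ∈ ⁅p.ker, (⊤ : Subgroup F)⁆) : q x = 1 := by
  have : ⁅p.ker, (⊤ : Subgroup F)⁆ ≤ q.ker := by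
    rw [Subgroup.commutator_le]
    intro a ha f _
    rw [MonoidHom.mem_ker, map_commutatorElement, commutatorElement_eq_one_iff_mul_comm]
    exact (Subgroup.mem_center_iff.1 (hq a ha) _).symm
  exact this hx

/-! ### The universal two-cocycle -/

/-- The boundaries of `3`-chains in the bar complex with coefficients in `ℤ`. -/
def bdry (G : Type*) [Group G] : AddSubgroup (FreeAbelianGroup (G × G)) :=
  AddSubgroup.closure {x | ∃ g h j : G, x = FreeAbelianGroup.of (h, j) -
    FreeAbelianGroup.of (g * h, j) + FreeAbelianGroup.of (g, h * j) - FreeAbelianGroup.of (g, h)}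

/-- The group of `2`-chains modulo boundaries. -/
abbrev ChainQuot (G : Type*) [Group G] : Type _ := FreeAbelianGroup (G × G) ⧸ bdry G

/-- The class of the basis element `(g, h)`. -/
def symb {G : Type*} [Group G] (g h : G) : ChainQuot G :=
  QuotientAddGroup.mk (FreeAbelianGroup.of (g, h))

theorem symb_cocycle {G : Type*} [Group G] (g h j : G) :
    symb (g * h) j + symb g h = symb h j + symb g (h * j) := by
  have h₁ : symb h j - symb (g * h) j + symb g (h * j) - symb g h = 0 :=
    (QuotientAddGroup.eq_zero_iff _).2 (AddSubgroup.subset_closure ⟨g, h, j, rfl⟩)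
  rw [sub_add_eq_add_sub, sub_sub, sub_eq_zero] at h₁
  exact h₁.symm

theorem symb_one_left {G : Type*} [Group G] (g : G) : symb 1 g = symb 1 1 := by
  simpa using (symb_cocycle 1 1 g).symm

theorem symb_one_right {G : Type*} [Group G] (g : G) : symb g 1 = symb 1 1 := by
  simpa using (symb_cocycle g 1 1)

/-- The homomorphism given by a two-cocycle. -/
def ChainQuot.lift {G M : Type*} [Group G] [AddCommGroup M] (f : G → G → M)
    (hf : ∀ g h j, f (g * h) j + f g h = f h j + f g (h * j)) : ChainQuot G →+ M :=
  QuotientAddGroup.lift (bdry G) (FreeAbelianGroup.lift fun x => f x.1 x.2) (by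
    refine ((AddSubgroup.closure_le
      (K := (FreeAbelianGroup.lift fun x : G × G => f x.1 x.2).ker)).2 ?_ : _)
    rintro _ ⟨g, h, j, rfl⟩
    simp only [SetLike.mem_coe, AddMonoidHom.mem_ker, map_sub, map_add,
      FreeAbelianGroup.lift_apply_of]
    rw [sub_add_eq_add_sub, sub_sub, sub_eq_zero, hf])

@[simp] theorem ChainQuot.lift_symb {G M : Type*} [Group G] [AddCommGroup M] (f : G → G → M)
    (hf : ∀ g h j, f (g * h) j + f g h = f h j + f g (h * j)) (g h : G) :
    ChainQuot.lift f hf (symb g h) = f g h := by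
  exact (QuotientAddGroup.lift_mk' _ _ _).trans (FreeAbelianGroup.lift_apply_of _ _)

theorem ChainQuot.induction {G : Type*} [Group G] {P : ChainQuot G → Prop}
    (symb : ∀ g h, P (symb g h)) (zero : P 0) (neg : ∀ a, P a → P (-a))
    (add : ∀ a b, P a → P b → P (a + b)) (a : ChainQuot G) : P a := by
  obtain ⟨x, rfl⟩ := QuotientAddGroup.mk_surjective a
  induction x using FreeAbelianGroup.induction_on with
  | zero => exact zero
  | of x => exact symb x.1 x.2
  | neg x hx => exact neg _ hx
  | add x y hx hy => exact add _ _ hx hy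

/-- The differential from `2`-chains to `1`-chains. -/
def chainD (G : Type*) [Group G] : ChainQuot G →+ FreeAbelianGroup G :=
  ChainQuot.lift (fun g h => FreeAbelianGroup.of h - FreeAbelianGroup.of (g * h) +
    FreeAbelianGroup.of g) (by intro g h j; simp only [mul_assoc]; abel)

@[simp] theorem chainD_symb {G : Type*} [Group G] (g h : G) : chainD G (symb g h) =
    FreeAbelianGroup.of h - FreeAbelianGroup.of (g * h) + FreeAbelianGroup.of g := by
  simp [chainD]

/-- The central extension of `G` given by the universal two-cocycle. -/
@[ext] structure UnivExt (G : Type*) [Group G] where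
  fibre : ChainQuot G
  base : G

namespace UnivExt

variable {G : Type*} [Group G]

instance : Mul (UnivExt G) := ⟨fun u v => ⟨u.fibre + v.fibre + symb u.base v.base,
  u.base * v.base⟩⟩

/-- The universal cocycle is not normalised, which is why `symb 1 1` enters the identity, the
inverse and `incl`. -/
instance : One (UnivExt G) := ⟨⟨-symb 1 1, 1⟩⟩

instance : Inv (UnivExt G) := ⟨fun u => ⟨-u.fibre - symb u.base⁻¹ u.base - symb 1 1, u.base⁻¹⟩⟩

theorem mul_def (u v : UnivExt G) :
    u * v = ⟨u.fibre + v.fibre + symb u.base v.base, u.base * v.base⟩ := rfl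

theorem one_def : (1 : UnivExt G) = ⟨-symb 1 1, 1⟩ := rfl

theorem inv_def (u : UnivExt G) :
    u⁻¹ = ⟨-u.fibre - symb u.base⁻¹ u.base - symb 1 1, u.base⁻¹⟩ := rfl

instance : Group (UnivExt G) := Group.ofLeftAxioms
  (by
    intro u v w
    simp only [mul_def, UnivExt.mk.injEq, mul_assoc, and_true]
    have h := symb_cocycle u.base v.base w.base
    calc _ = u.fibre + v.fibre + w.fibre + (symb (u.base * v.base) w.base + symb u.base v.base) := by
          abel
      _ = _ := by rw [h]; abel)
  (by
    intro u
    simp [mul_def, one_def, symb_one_left])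
  (by
    intro u
    simp only [mul_def, one_def, inv_def, UnivExt.mk.injEq, inv_mul_cancel, and_true]
    abel)

/-- The projection of the universal extension. -/
def proj (G : Type*) [Group G] : UnivExt G →* G where
  toFun := base
  map_one' := rfl
  map_mul' _ _ := rfl

/-- The homomorphism to `1`-chains which extends the differential. -/
def chi (G : Type*) [Group G] : UnivExt G →* Multiplicative (FreeAbelianGroup G) where
  toFun u := Multiplicative.ofAdd (chainD G u.fibre + FreeAbelianGroup.of u.base)
  map_one' := by
    rw [← ofAdd_zero]
    congr 1
    simp [one_def]
  map_mul' u v := by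
    rw [← ofAdd_add]
    congr 1
    simp only [mul_def, map_add, chainD_symb]
    abel

/-- The inclusion of the fibre. -/
def incl (G : Type*) [Group G] : Multiplicative (ChainQuot G) →* UnivExt G where
  toFun a := ⟨a.toAdd - symb 1 1, 1⟩
  map_one' := by simp [one_def]
  map_mul' a b := by
    simp only [mul_def, toAdd_mul, UnivExt.mk.injEq, mul_one, and_true]
    abel

theorem incl_mul (a : ChainQuot G) (u : UnivExt G) :
    incl G (.ofAdd a) * u = ⟨a + u.fibre, u.base⟩ := by
  simp only [incl, mul_def, MonoidHom.coe_mk, OneHom.coe_mk, toAdd_ofAdd, one_mul,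
    UnivExt.mk.injEq, symb_one_left, and_true]
  abel

theorem mul_incl (a : ChainQuot G) (u : UnivExt G) :
    u * incl G (.ofAdd a) = ⟨a + u.fibre, u.base⟩ := by
  simp only [incl, mul_def, MonoidHom.coe_mk, OneHom.coe_mk, toAdd_ofAdd, mul_one,
    UnivExt.mk.injEq, symb_one_right, and_true]
  abel

theorem incl_mem_center (a : ChainQuot G) : incl G (.ofAdd a) ∈ Subgroup.center (UnivExt G) := by
  rw [Subgroup.mem_center_iff]
  intro u
  rw [incl_mul, mul_incl]

theorem eq_incl_of_base_eq_one (u : UnivExt G) (hu : u.base = 1) :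
    u = incl G (.ofAdd (u.fibre + symb 1 1)) := by
  ext
  · simp [incl]
  · exact hu

end UnivExt

/-! ### Hopf's formula -/

/-- A free group maps to the universal extension. -/
theorem exists_lift_of_surjective {X E G : Type*} [Group E] [Group G] (π : E →* G)
    (hπ : Function.Surjective π) (p : FreeGroup X →* G) :
    ∃ q : FreeGroup X →* E, ∀ x, π (q x) = p x := by
  choose s hs using hπ
  refine ⟨FreeGroup.lift fun x => s (p (FreeGroup.of x)), fun x => ?_⟩
  have : π.comp (FreeGroup.lift fun x => s (p (FreeGroup.of x))) = p := by
    ext x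
    simp [hs]
  exact DFunLike.congr_fun this x

section Hopf

variable {F G : Type*} [Group F] [Group G] (p : F →* G) (s : G → F) (hs : ∀ g, p (s g) = g)

/-- The two-cocycle of the central extension `F ⧸ [ker p, F]` of `G`. -/
def quotCocycle (g h : G) : Subgroup.center (F ⧸ ⁅p.ker, (⊤ : Subgroup F)⁆) :=
  ⟨QuotientGroup.mk' _ (s g * s h * (s (g * h))⁻¹), mk_mem_center p (by
    simp [MonoidHom.mem_ker, hs])⟩

theorem mk_mul_mk_section (g h : G) :
    QuotientGroup.mk' ⁅p.ker, (⊤ : Subgroup F)⁆ (s g) * QuotientGroup.mk' _ (s h) =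
      (quotCocycle p s hs g h).1 * QuotientGroup.mk' _ (s (g * h)) := by
  rw [quotCocycle, ← map_mul, ← map_mul, inv_mul_cancel_right]

theorem quotCocycle_cocycle (g h j : G) :
    quotCocycle p s hs (g * h) j * quotCocycle p s hs g h =
      quotCocycle p s hs h j * quotCocycle p s hs g (h * j) := by
  apply Subtype.ext
  rw [Subgroup.coe_mul, Subgroup.coe_mul]
  -- After multiplication by the image of `s (g * h * j)` both sides become the product of the three
  -- section values, bracketed in two ways.
  apply mul_right_cancel (b := QuotientGroup.mk' ⁅p.ker, (⊤ : Subgroup F)⁆ (s (g * h * j)))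
  have hc (u v : G) := Subgroup.mem_center_iff.1 (quotCocycle p s hs u v).2
  rw [hc g h, mul_assoc, ← mk_mul_mk_section, ← mul_assoc, ← mk_mul_mk_section,
    mul_assoc g, mul_assoc _ _ (QuotientGroup.mk' _ (s (g * (h * j)))), ← mk_mul_mk_section,
    ← mul_assoc, ← hc h j, mul_assoc _ _ (QuotientGroup.mk' _ (s (h * j))), ← mk_mul_mk_section,
    mul_assoc]

/-- The homomorphism from `2`-chains given by `quotCocycle`. -/
def evalQuot : ChainQuot G →+ Additive (Subgroup.center (F ⧸ ⁅p.ker, (⊤ : Subgroup F)⁆)) :=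
  ChainQuot.lift (fun g h => Additive.ofMul (quotCocycle p s hs g h))
    fun g h j => congrArg Additive.ofMul (quotCocycle_cocycle p s hs g h j)

/-- The homomorphism from the universal extension to `F ⧸ [ker p, F]`. -/
def fromUnivExt : UnivExt G →* F ⧸ ⁅p.ker, (⊤ : Subgroup F)⁆ :=
  MonoidHom.mk' (fun u => (evalQuot p s hs u.fibre).toMul.1 * QuotientGroup.mk' _ (s u.base)) (by
    intro u v
    have hc (a : ChainQuot G) := Subgroup.mem_center_iff.1 (evalQuot p s hs a).toMul.2
    have h := mk_mul_mk_section p s hs u.base v.base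
    have h₁ : (evalQuot p s hs (symb u.base v.base)).toMul = quotCocycle p s hs u.base v.base := by
      simp [evalQuot]
    simp only [UnivExt.mul_def, map_add, toMul_add, Subgroup.coe_mul, h₁]
    rw [mul_assoc, ← h, mul_assoc, mul_assoc, ← mul_assoc _ _ (QuotientGroup.mk' _ (s v.base)),
      ← hc v.fibre]
    simp only [mul_assoc])

/-- Both maps lift `p` to the central extension `F ⧸ [ker p, F]`. This shows that an element of `N ∩
F'` killed by `t` lies in `[N, F]`. -/
theorem fromUnivExt_comp_eqOn (t : F →* UnivExt G) (ht : ∀ x, (t x).base = p x) {x : F}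
    (hx : x ∈ commutator F) : fromUnivExt p s hs (t x) = QuotientGroup.mk' _ x := by
  refine eqOn_commutator_of_mul_inv_mem_center ((fromUnivExt p s hs).comp t)
    (QuotientGroup.mk' _) (fun y => ?_) hx
  have h : (fromUnivExt p s hs).comp t y * (QuotientGroup.mk' _ y)⁻¹ =
      (evalQuot p s hs (t y).fibre).toMul.1 * QuotientGroup.mk' _ (s (p y) * y⁻¹) := by
    rw [map_mul, map_inv, ← mul_assoc, ← ht]
    rfl
  rw [h]
  exact mul_mem (Subtype.prop _) (mk_mem_center p (by simp [MonoidHom.mem_ker, hs]))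

/-- This supplies preimages in Hopf's formula. The class of `x` in the abelianization and the
correction to `t x` both factor through `chainD`, so for a cycle `a` the element `x` lies in `F'`
and `t x` is exactly the image of `a`. -/
theorem map_evalQuot (t : F →* UnivExt G) (ht : ∀ x, (t x).base = p x) (a : ChainQuot G) :
    ∃ x : F, QuotientGroup.mk' _ x = (evalQuot p s hs a).toMul.1 ∧ p x = 1 ∧
      Additive.ofMul (Abelianization.of x) = (FreeAbelianGroup.lift fun g =>
        Additive.ofMul (Abelianization.of (s g)) : _ →+ _) (chainD G a) ∧
      t x = UnivExt.incl G (.ofAdd (a + FreeAbelianGroup.lift (fun g => (t (s g)).fibre)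
        (chainD G a))) := by
  induction a using ChainQuot.induction with
  | symb g h =>
    refine ⟨s g * s h * (s (g * h))⁻¹, ?_, ?_, ?_, ?_⟩
    · simp [evalQuot, quotCocycle]
    · simp [hs]
    · simp only [chainD_symb, map_add, map_sub, map_mul, map_inv, FreeAbelianGroup.lift_apply_of]
      rw [mul_comm (Abelianization.of (s g)), mul_right_comm]
      simp [sub_eq_add_neg]
    · rw [map_mul, map_inv, mul_inv_eq_iff_eq_mul, UnivExt.incl_mul, map_mul, UnivExt.mul_def]
      ext
      · simp only [ht, hs, chainD_symb, map_add, map_sub, FreeAbelianGroup.lift_apply_of]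
        abel
      · simp [ht, hs]
  | zero => exact ⟨1, by simp⟩
  | neg a ih =>
    obtain ⟨x, h₁, h₂, h₃, h₄⟩ := ih
    refine ⟨x⁻¹, ?_, ?_, ?_, ?_⟩
    · simp [map_inv, h₁]
    · simp [h₂]
    · rw [map_inv, ofMul_inv, h₃, map_neg, map_neg]
    · rw [map_inv, h₄, ← map_inv, ← ofAdd_neg, AddMonoidHom.map_neg, AddMonoidHom.map_neg, neg_add]
  | add a b iha ihb =>
    obtain ⟨x, h₁, h₂, h₃, h₄⟩ := iha
    obtain ⟨y, k₁, k₂, k₃, k₄⟩ := ihb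
    refine ⟨x * y, ?_, ?_, ?_, ?_⟩
    · simp [map_mul, h₁, k₁]
    · simp [h₂, k₂]
    · rw [map_mul, ofMul_mul, h₃, k₃, map_add, map_add]
    · rw [map_mul, h₄, k₄, ← map_mul, ← ofAdd_add, AddMonoidHom.map_add, AddMonoidHom.map_add]
      congr 2
      abel

end Hopf

/-- Hopf's formula, with `H₂(G, ℤ)` as the group of `2`-cycles modulo boundaries. -/
theorem exists_hopf_chainQuot {X G : Type*} [Group G] (p : FreeGroup X →* G)
    (hp : Function.Surjective p) :
    ∃ ψ : (p.ker ⊓ commutator (FreeGroup X) : Subgroup _) →* Multiplicative (chainD G).ker,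
      Function.Surjective ψ ∧
      ∀ x, ψ x = 1 ↔ (x : FreeGroup X) ∈ ⁅p.ker, (⊤ : Subgroup (FreeGroup X))⁆ := by
  obtain ⟨t, ht⟩ := exists_lift_of_surjective (UnivExt.proj G) (fun g => ⟨⟨0, g⟩, rfl⟩) p
  replace ht : ∀ x, (t x).base = p x := ht
  choose s hs using hp
  have hbase : ∀ x : (p.ker ⊓ commutator (FreeGroup X) : Subgroup _), (t x).base = 1 :=
    fun x => (ht x).trans x.2.1
  have hincl := fun x => UnivExt.eq_incl_of_base_eq_one _ (hbase x)
  have hmem : ∀ x : (p.ker ⊓ commutator (FreeGroup X) : Subgroup _),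
      (t x).fibre + symb 1 1 ∈ (chainD G).ker := by
    intro x
    -- `chi` has an abelian target, so it kills the image of `F'`. Over base `1` this says that the
    -- shifted fibre is a cycle, since `chainD` sends `symb 1 1` to the basis element `1`.
    have h : UnivExt.chi G (t x) = 1 := by
      have := Abelianization.commutator_subset_ker ((UnivExt.chi G).comp t) x.2.2
      exact this
    have h : chainD G (t x).fibre + FreeAbelianGroup.of (t x).base = 0 := h
    rw [AddMonoidHom.mem_ker, map_add, chainD_symb]
    rw [hbase] at h
    simpa using h
  let ψ : (p.ker ⊓ commutator (FreeGroup X) : Subgroup _) →* Multiplicative (chainD G).ker :=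
    MonoidHom.mk' (fun x => .ofAdd ⟨(t x).fibre + symb 1 1, hmem x⟩) (by
      intro x y
      rw [← ofAdd_add]
      congr 1
      apply Subtype.ext
      simp only [Subgroup.coe_mul, map_mul, UnivExt.mul_def, AddSubgroup.coe_add, hbase]
      abel)
  have hψ : ∀ x, ψ x = 1 ↔ t x = 1 := by
    intro x
    have h₁ : ψ x = 1 ↔ (t x).fibre + symb 1 1 = 0 := by
      change (⟨_, hmem x⟩ : (chainD G).ker) = 0 ↔ _
      exact Subtype.ext_iff
    rw [h₁, UnivExt.ext_iff, hbase, UnivExt.one_def]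
    simp [add_eq_zero_iff_eq_neg]
  refine ⟨ψ, ?_, ?_⟩
  · intro z
    obtain ⟨z, hz⟩ := z
    obtain ⟨x, h₁, h₂, h₃, h₄⟩ := map_evalQuot p s hs t ht z
    rw [AddMonoidHom.mem_ker] at hz
    rw [hz, map_zero] at h₃ h₄
    refine ⟨⟨x, h₂, (mem_commutator_iff x).2 h₃⟩, ?_⟩
    apply congrArg Multiplicative.ofAdd
    apply Subtype.ext
    change (t x).fibre + symb 1 1 = z
    rw [h₄]
    simp [UnivExt.incl]
  · intro x
    rw [hψ]
    constructor
    · intro h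
      have h₁ := fromUnivExt_comp_eqOn p s hs t ht x.2.2
      rw [h, map_one] at h₁
      exact (QuotientGroup.eq_one_iff _).1 h₁.symm
    · intro h
      refine map_eq_one_of_mem_ker_commutator p t (fun y hy => ?_) h
      rw [UnivExt.eq_incl_of_base_eq_one _ ((ht y).trans hy)]
      exact UnivExt.incl_mem_center _

/-! ### Comparison with the bar complex of group homology -/

/-- The comparison of `2`-chains. -/
noncomputable def chainsEquiv (G : Type u) [Group G] :
    FreeAbelianGroup (G × G) ≃+ (G × G →₀ Rep.trivial (ULift.{u} ℤ) G (ULift.{u} ℤ)) :=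
  (FreeAbelianGroup.equivFinsupp _).trans (Finsupp.mapRange.addEquiv AddEquiv.ulift.symm)

/-- The comparison of `1`-chains. -/
noncomputable def chainsEquiv₁ (G : Type u) [Group G] :
    FreeAbelianGroup G ≃+ (G →₀ Rep.trivial (ULift.{u} ℤ) G (ULift.{u} ℤ)) :=
  (FreeAbelianGroup.equivFinsupp _).trans (Finsupp.mapRange.addEquiv AddEquiv.ulift.symm)

open groupHomology in
-- Under `chainsEquiv` the differential `d₂₁` becomes `chainD` and `boundaries₂` becomes `bdry`.
-- Both groups are then quotients of `cycles₂` by the same kernel.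
theorem H2Z_equiv (G : Type u) [Group G] : Nonempty (H2Z G ≃+ (chainD G).ker) := by
  let T := Rep.trivial (ULift.{u} ℤ) G (ULift.{u} ℤ)
  have hof : ∀ x, chainsEquiv G (.of x) = Finsupp.single x (ULift.up 1) := by
    intro x; simp [chainsEquiv]; rfl
  have hof₁ : ∀ x, chainsEquiv₁ G (.of x) = Finsupp.single x (ULift.up 1) := by
    intro x; simp [chainsEquiv₁]; rfl
  have hd : ∀ x, d₂₁ T (chainsEquiv G x) = chainsEquiv₁ G (chainD G (QuotientAddGroup.mk x)) := by
    intro x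
    have h : (d₂₁ T).hom.toAddMonoidHom.comp (chainsEquiv G).toAddMonoidHom =
        ((chainsEquiv₁ G).toAddMonoidHom.comp (chainD G)).comp (QuotientAddGroup.mk' _) := by
      refine FreeAbelianGroup.lift_ext _ _ ?_
      rintro ⟨g, h⟩
      change d₂₁ T (chainsEquiv G (.of (g, h))) = chainsEquiv₁ G (chainD G (symb g h))
      rw [hof, chainD_symb, d₂₁_single]
      simp [hof₁]
    exact DFunLike.congr_fun h x
  have hb : ∀ x, chainsEquiv G x ∈ boundaries₂ T ↔ x ∈ bdry G := by
    have hg : ∀ g h j : G, d₃₂ T (Finsupp.single (g, h, j) (ULift.up 1)) = chainsEquiv G (.of (h, j) -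
        .of (g * h, j) + .of (g, h * j) - .of (g, h)) := by
      intro g h j
      rw [d₃₂_single]
      simp [hof]
    intro x
    constructor
    · rintro ⟨y, hy⟩
      rw [← (chainsEquiv G).symm_apply_apply x, ← hy]
      clear hy
      induction y using Finsupp.induction_linear with
      | zero => simp
      | add a b ha hb => simpa using add_mem ha hb
      | single a n =>
        obtain ⟨g, h, j⟩ := a
        obtain ⟨n, rfl⟩ : ∃ m : ℤ, n = m • (ULift.up 1 : ULift.{u} ℤ) := ⟨n.down, by ext; simp⟩
        rw [← Finsupp.smul_single, map_zsmul, map_zsmul]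
        refine zsmul_mem ?_ n
        have h₁ := hg g h j
        rw [← AddEquiv.symm_apply_eq] at h₁
        exact h₁ ▸ AddSubgroup.subset_closure ⟨g, h, j, rfl⟩
    · intro hx
      induction hx using AddSubgroup.closure_induction with
      | mem x hx =>
        obtain ⟨g, h, j, rfl⟩ := hx
        exact ⟨_, hg g h j⟩
      | zero => rw [map_zero]; exact zero_mem _
      | add a b _ _ ha hb => rw [map_add]; exact add_mem ha hb
      | neg a _ ha => rw [map_neg]; exact neg_mem ha
  let f : cycles₂ T →+ (chainD G).ker :=
    { toFun := fun z => ⟨QuotientAddGroup.mk ((chainsEquiv G).symm z.1), by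
        rw [AddMonoidHom.mem_ker, ← (chainsEquiv₁ G).map_eq_zero_iff, ← hd,
          AddEquiv.apply_symm_apply]
        exact z.2⟩
      map_zero' := by ext; simp
      map_add' := by intro a b; ext; simp }
  have hf : Function.Surjective f := by
    rintro ⟨z, hz⟩
    obtain ⟨x, rfl⟩ := QuotientAddGroup.mk_surjective z
    refine ⟨⟨chainsEquiv G x, ?_⟩, Subtype.ext ?_⟩
    · change d₂₁ T _ = 0
      rw [hd, hz, map_zero]
    · simp [f]
  have hπ : Function.Surjective (H2π T) := (ModuleCat.epi_iff_surjective _).1 inferInstance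
  have hk : (H2π T).hom.toAddMonoidHom.ker = f.ker := by
    ext z
    have h₁ : f z = 0 ↔ (chainsEquiv G).symm z.1 ∈ bdry G := by
      rw [← QuotientAddGroup.eq_zero_iff]
      exact Subtype.ext_iff
    rw [AddMonoidHom.mem_ker, AddMonoidHom.mem_ker, h₁, ← hb, AddEquiv.apply_symm_apply]
    exact H2π_eq_zero_iff z
  exact ⟨(QuotientAddGroup.quotientKerEquivOfSurjective _ hπ).symm.trans
    ((QuotientAddGroup.quotientAddEquivOfEq hk).trans
      (QuotientAddGroup.quotientKerEquivOfSurjective f hf))⟩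

/-- Hopf's formula: `H₂(G, ℤ)` is `(N ∩ F') / [N, F]`. -/
theorem exists_hopf {X : Type*} {G : Type u} [Group G] (p : FreeGroup X →* G)
    (hp : Function.Surjective p) :
    ∃ ψ : (p.ker ⊓ commutator (FreeGroup X) : Subgroup _) →* Multiplicative (H2Z G),
      Function.Surjective ψ ∧
      ∀ x, ψ x = 1 ↔ (x : FreeGroup X) ∈ ⁅p.ker, (⊤ : Subgroup (FreeGroup X))⁆ := by
  obtain ⟨ψ, h₁, h₂⟩ := exists_hopf_chainQuot p hp
  obtain ⟨e⟩ := H2Z_equiv G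
  refine ⟨(AddEquiv.toMultiplicative e.symm).toMonoidHom.comp ψ,
    (AddEquiv.toMultiplicative e.symm).surjective.comp h₁, fun x => ?_⟩
  rw [← h₂]
  exact (AddEquiv.toMultiplicative e.symm).map_eq_one_iff

/-! ### A lower bound for the Schur multiplier -/

/-- `ℂˣ` is divisible because `ℂ` is algebraically closed, and divisible abelian groups are
injective by Baer's criterion. -/
theorem exists_addMonoidHom_extension {A : Type*} [AddCommGroup A] (B : AddSubgroup A)
    (f : B →+ Additive ℂˣ) : ∃ g : A →+ Additive ℂˣ, ∀ b : B, g b = f b := by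
  let _ : DivisibleBy (Additive ℂˣ) ℤ := divisibleByOfSMulRightSurj _ _ (by
    intro n hn z
    replace hn : n ≠ 0 := hn
    obtain ⟨w, hw⟩ := IsAlgClosed.exists_pow_nat_eq (z.toMul : ℂ) (Int.natAbs_pos.2 hn)
    have hw₀ : w ≠ 0 := by
      rintro rfl
      rw [zero_pow (Int.natAbs_pos.2 hn).ne'] at hw
      exact z.toMul.ne_zero hw.symm
    have h : n.natAbs • Additive.ofMul (Units.mk0 w hw₀) = z := by
      apply Additive.toMul.injective
      ext
      simpa using hw
    rcases Int.natAbs_eq n with h' | h'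
    · exact ⟨.ofMul (Units.mk0 w hw₀), by
        change n • _ = z
        rw [h', natCast_zsmul, h]⟩
    · exact ⟨-.ofMul (Units.mk0 w hw₀), by
        change n • _ = z
        rw [h', neg_smul, smul_neg, neg_neg, natCast_zsmul, h]⟩)
  obtain ⟨g, hg⟩ := (Module.Baer.of_divisible (Additive ℂˣ)).extension_property_addMonoidHom
    B.subtype B.subtype_injective f
  exact ⟨g, fun b => DFunLike.congr_fun hg b⟩

open groupCohomology in
/-- The half of the universal coefficient theorem which bounds the Schur multiplier from below. -/
theorem exists_injective_schurMultiplier (G : Type u) [Group G] :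
    ∃ f : ((chainD G).ker →+ Additive ℂˣ) → schurMultiplier G, Function.Injective f := by
  let T := Rep.trivial (ULift.{u} ℤ) G (ULift.{u} (Additive ℂˣ))
  choose ext hext using exists_addMonoidHom_extension (chainD G).ker
  -- A character of the cycles, extended to all chains modulo boundaries, is a two-cocycle when
  -- evaluated on the symbols.
  let c : ((chainD G).ker →+ Additive ℂˣ) → cocycles₂ T := fun χ =>
    ⟨fun x => ULift.up (ext χ (symb x.1 x.2)), by
      rw [mem_cocycles₂_iff]
      intro g h j
      change ULift.up (ext χ (symb (g * h) j) + ext χ (symb g h)) =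
        ULift.up (ext χ (symb h j) + ext χ (symb g (h * j)))
      rw [← map_add, ← map_add, symb_cocycle]⟩
  refine ⟨fun χ => H2π T (c χ), fun χ₁ χ₂ h => ?_⟩
  rw [H2π_eq_iff] at h
  obtain ⟨t, ht⟩ := h
  let t' : FreeAbelianGroup G →+ Additive ℂˣ := FreeAbelianGroup.lift fun g => (t g).down
  -- Cohomologous cocycles differ by a map that factors through `chainD`, so the two characters
  -- agree on cycles.
  have key : ∀ a, ext χ₁ a - ext χ₂ a = t' (chainD G a) := by
    intro a
    induction a using ChainQuot.induction with
    | symb g h =>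
      have h₁ := congrArg ULift.down (congrFun ht (g, h))
      simp only [chainD_symb, map_add, map_sub, t', FreeAbelianGroup.lift_apply_of]
      exact h₁.symm
    | zero => simp
    | neg a ha => simp only [map_neg, ← ha]; abel
    | add a b ha hb => simp only [map_add, ← ha, ← hb]; abel
  ext1 z
  have h := key z
  rw [z.2, map_zero, sub_eq_zero, hext, hext] at h
  exact h

/-- A finite abelian group has as many characters with values in `ℂˣ` as elements. -/
theorem nat_card_le_schurMultiplier (G : Type u) [Group G] [Finite (chainD G).ker]
    [Finite (schurMultiplier G)] : Nat.card (chainD G).ker ≤ Nat.card (schurMultiplier G) := by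
  obtain ⟨f, hf⟩ := exists_injective_schurMultiplier G
  have : NeZero (Monoid.exponent (Multiplicative (chainD G).ker)) :=
    ⟨Monoid.exponent_ne_zero_of_finite⟩
  obtain ⟨e⟩ := CommGroup.monoidHom_mulEquiv_of_hasEnoughRootsOfUnity
    (Multiplicative (chainD G).ker) ℂ
  have h₁ : Nat.card (chainD G).ker = Nat.card ((chainD G).ker →+ Additive ℂˣ) := by
    rw [← Nat.card_congr (AddMonoidHom.toMultiplicativeLeft (α := (chainD G).ker) (β := ℂˣ)).symm,
      Nat.card_congr e.toEquiv]
    rfl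
  rw [h₁]
  exact Nat.card_le_card_of_injective f hf

/-! ### Commutators in central extensions, and Schur covers -/

theorem commutatorElement_mul_of_mem_center {H : Type*} [Group H] {a b x y : H}
    (ha : a * x⁻¹ ∈ Subgroup.center H) (hb : b * y⁻¹ ∈ Subgroup.center H) : ⁅a, b⁆ = ⁅x, y⁆ := by
  obtain ⟨z, rfl⟩ : ∃ z, a = z * x := ⟨a * x⁻¹, by simp⟩
  obtain ⟨w, rfl⟩ : ∃ w, b = w * y := ⟨b * y⁻¹, by simp⟩
  rw [mul_inv_cancel_right, Subgroup.mem_center_iff] at ha hb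
  have h₁ : ⁅z * x, w * y⁆ = ⁅x, w * y⁆ := by
    simp only [commutatorElement_def, mul_inv_rev]
    rw [← ha x]
    have := ha (w * y)
    calc x * z * (w * y) * (x⁻¹ * z⁻¹) * (y⁻¹ * w⁻¹)
        = x * (z * (w * y * x⁻¹)) * z⁻¹ * (y⁻¹ * w⁻¹) := by group
      _ = _ := by rw [← ha]; group
  rw [h₁]
  simp only [commutatorElement_def, mul_inv_rev]
  calc x * (w * y) * x⁻¹ * (y⁻¹ * w⁻¹) = (x * w) * (y * x⁻¹ * y⁻¹) * w⁻¹ := by group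
    _ = _ := by rw [hb, mul_assoc w, ← hb]; group

theorem map_commutator_eq_of_center {F H : Type*} [Group F] [Group H] (q : F →* H)
    (hq : ∀ h, ∃ x, h * (q x)⁻¹ ∈ Subgroup.center H) :
    (commutator F).map q = commutator H := by
  apply le_antisymm
  · rintro _ ⟨x, hx, rfl⟩
    exact commutator_map_mem q hx
  · rw [commutator_def H, Subgroup.commutator_le]
    intro a _ b _
    obtain ⟨x, hx⟩ := hq a
    obtain ⟨y, hy⟩ := hq b
    rw [commutatorElement_mul_of_mem_center hx hy, ← map_commutatorElement]
    exact ⟨_, Subgroup.commutator_mem_commutator trivial trivial, rfl⟩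

theorem map_commutator_eq_of_lift {F G H : Type*} [Group F] [Group G] [Group H] (π : H →* G)
    (hπ : π.ker ≤ Subgroup.center H) (p : F →* G) (hp : Function.Surjective p) (q : F →* H)
    (hq : ∀ x, π (q x) = p x) : (commutator F).map q = commutator H := by
  refine map_commutator_eq_of_center q fun h => ?_
  obtain ⟨x, hx⟩ := hp (π h)
  exact ⟨x, hπ (by simp [MonoidHom.mem_ker, hq, hx])⟩

/-- Schur's theorem: a commutator depends only on the images in `G` of its entries, so there are
finitely many commutators, and this makes the subgroup that they generate finite. -/
theorem finite_commutator_of_center {H G : Type*} [Group H] [Group G] [Finite G] (π : H →* G)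
    (hπ : π.ker ≤ Subgroup.center H) : Finite (commutator H) := by
  have : Finite (commutatorSet H) := by
    choose s hs using fun g : Set.range π => g.2
    have : commutatorSet H ⊆ Set.range fun x : Set.range π × Set.range π => ⁅s x.1, s x.2⁆ := by
      rintro _ ⟨a, b, rfl⟩
      refine ⟨(⟨π a, a, rfl⟩, ⟨π b, b, rfl⟩), (commutatorElement_mul_of_mem_center ?_ ?_).symm⟩ <;>
      exact hπ (by simp [MonoidHom.mem_ker, hs])
    exact (Set.finite_range _).subset this
  infer_instance

/-- By Hopf's formula the cycles modulo boundaries embed in the commutator subgroup of `F ⧸ [N, F]`,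
a central extension of the finite group `G`. -/
theorem finite_chainD_ker (G : Type u) [Group G] [Finite G] : Finite (chainD G).ker := by
  let p : FreeGroup G →* G := FreeGroup.lift id
  have hp : Function.Surjective p := fun g => ⟨.of g, by simp [p]⟩
  obtain ⟨ψ, h₁, h₂⟩ := exists_hopf_chainQuot p hp
  let R := ⁅p.ker, (⊤ : Subgroup (FreeGroup G))⁆
  have hR : R ≤ p.ker := Subgroup.commutator_le_left _ _
  have : Finite (commutator (FreeGroup G ⧸ R)) := by
    refine finite_commutator_of_center (QuotientGroup.lift R p hR) ?_
    intro y hy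
    obtain ⟨x, rfl⟩ := QuotientGroup.mk_surjective y
    exact mk_mem_center p hy
  choose s hs using h₁
  refine Finite.of_injective (β := commutator (FreeGroup G ⧸ R))
    (fun z => ⟨QuotientGroup.mk' R (s (.ofAdd z)), commutator_map_mem _ (s _).2.2⟩) ?_
  intro z w h
  have h : QuotientGroup.mk' R (s (.ofAdd z)) = QuotientGroup.mk' R (s (.ofAdd w)) :=
    congrArg Subtype.val h
  have h₃ : ((s (.ofAdd z))⁻¹ * s (.ofAdd w) : (p.ker ⊓ commutator (FreeGroup G) : Subgroup _)).1
      ∈ R := QuotientGroup.eq.1 h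
  rw [← h₂, map_mul, map_inv, hs, hs, inv_mul_eq_one] at h₃
  exact h₃

/-- For a Schur cover `H` of `G = F / N`, the kernel of `F' → H'` is `[N, F]`. -/
theorem IsSchurCover.mem_ker_commutator {X : Type*} {H : Type v} {G : Type u} [Group H] [Group G]
    [Finite G] {π : H →* G} (h : IsSchurCover π) (p : FreeGroup X →* G)
    (hp : Function.Surjective p) (q : FreeGroup X →* H) (hq : ∀ x, π (q x) = p x)
    {x : FreeGroup X} (hx : x ∈ commutator (FreeGroup X)) (hx₁ : q x = 1) :
    x ∈ ⁅p.ker, (⊤ : Subgroup (FreeGroup X))⁆ := by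
  obtain ⟨ψ, h₁, h₂⟩ := exists_hopf_chainQuot p hp
  have := finite_chainD_ker G
  choose s hs using h₁
  -- The chosen preimage under `ψ` is irrelevant because `q` kills `[N, F]`.
  have hs' : ∀ y, q (s (ψ y)) = q y := by
    intro y
    have h₃ : ψ ((s (ψ y)) * y⁻¹) = 1 := by rw [map_mul, hs, map_inv, mul_inv_cancel]
    rw [h₂] at h₃
    have := map_eq_one_of_mem_ker_commutator p q
      (fun a ha => h.ker_le_center ((hq a).trans ha)) h₃
    rwa [Subgroup.coe_mul, map_mul, Subgroup.coe_inv, map_inv, mul_inv_eq_one] at this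
  let κ : Multiplicative (chainD G).ker → π.ker := fun z =>
    ⟨q (s z), (hq _).trans (s z).2.1⟩
  -- The kernel of `π` lies in `H'`, which is the image of `F'`, so each of its elements comes from
  -- `N ∩ F'`.
  have hκ : Function.Surjective κ := by
    rintro ⟨m, hm⟩
    have hm' := h.ker_le_commutator hm
    rw [← map_commutator_eq_of_lift π h.ker_le_center p hp q hq] at hm'
    obtain ⟨y, hy, rfl⟩ := hm'
    exact ⟨ψ ⟨y, (hq y).symm.trans hm, hy⟩, Subtype.ext (hs' _)⟩
  obtain ⟨e⟩ := h.ker_iso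
  have : Finite π.ker := Finite.of_surjective κ hκ
  have : Finite (schurMultiplier G) := Finite.of_equiv _ e.toEquiv
  have hcard : Nat.card (Multiplicative (chainD G).ker) ≤ Nat.card π.ker := by
    rw [Nat.card_congr e.toEquiv]
    exact nat_card_le_schurMultiplier G
  have hbij := hκ.bijective_of_nat_card_le hcard
  have hxp : p x = 1 := by rw [← hq, hx₁, map_one]
  let y : (p.ker ⊓ commutator (FreeGroup X) : Subgroup _) := ⟨x, hxp, hx⟩
  change y.1 ∈ _
  rw [← h₂]
  apply hbij.1
  apply Subtype.ext
  change q (s (ψ y)) = q (s 1)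
  rw [hs', ← map_one ψ, hs', Subgroup.coe_one, map_one]
  exact hx₁

/-! ### The non-abelian exterior square -/

section Tau

variable {G : Type*} [Group G]

/-- The universal property of `ν(G)`. -/
def nuLift {T : Type*} [Group T] (a b : G →* T)
    (h₁ : ∀ x y z, rconj (rcomm (a x) (b y)) (a z) = rcomm (a (rconj x z)) (b (rconj y z)))
    (h₂ : ∀ x y z, rconj (rcomm (a x) (b y)) (b z) = rcomm (a (rconj x z)) (b (rconj y z))) :
    Nu G →* T :=
  QuotientGroup.lift _ (Monoid.Coprod.lift a b) (by
    refine (Subgroup.normalClosure_le_normal (N := (Monoid.Coprod.lift a b).ker) ?_ : _)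
    rintro r ⟨x, y, z, rfl | rfl⟩
    · have := h₁ x y z
      simp only [rconj, rcomm, map_mul, map_inv] at this
      rw [SetLike.mem_coe, MonoidHom.mem_ker, map_mul, map_inv, mul_inv_eq_one]
      simp only [rconj, rcomm, map_mul, map_inv, Monoid.Coprod.lift_apply_inl,
        Monoid.Coprod.lift_apply_inr]
      exact this
    · have := h₂ x y z
      simp only [rconj, rcomm, map_mul, map_inv] at this
      rw [SetLike.mem_coe, MonoidHom.mem_ker, map_mul, map_inv, mul_inv_eq_one]
      simp only [rconj, rcomm, map_mul, map_inv, Monoid.Coprod.lift_apply_inl,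
        Monoid.Coprod.lift_apply_inr]
      exact this)

section

variable {T : Type*} [Group T] (a b : G →* T)
    (h₁ : ∀ x y z, rconj (rcomm (a x) (b y)) (a z) = rcomm (a (rconj x z)) (b (rconj y z)))
    (h₂ : ∀ x y z, rconj (rcomm (a x) (b y)) (b z) = rcomm (a (rconj x z)) (b (rconj y z)))

theorem nuLift_nuL (x : G) : nuLift a b h₁ h₂ (nuL G x) = a x := by
  simp [nuLift, nuL]

theorem nuLift_nuR (x : G) : nuLift a b h₁ h₂ (nuR G x) = b x := by
  simp [nuLift, nuR]

end

/-- The universal property of `τ(G)`. -/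
def tauLift {T : Type*} [Group T] (a b : G →* T)
    (h₁ : ∀ x y z, rconj (rcomm (a x) (b y)) (a z) = rcomm (a (rconj x z)) (b (rconj y z)))
    (h₂ : ∀ x y z, rconj (rcomm (a x) (b y)) (b z) = rcomm (a (rconj x z)) (b (rconj y z)))
    (h₃ : ∀ x, rcomm (a x) (b x) = 1) : Tau G →* T :=
  QuotientGroup.lift (nabla G) (nuLift a b h₁ h₂) (by
    refine ((Subgroup.closure_le (K := (nuLift a b h₁ h₂).ker)).2 ?_ : _)
    rintro _ ⟨x, rfl⟩
    have h := h₃ x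
    rw [← nuLift_nuL a b h₁ h₂, ← nuLift_nuR a b h₁ h₂] at h
    simp only [rcomm, ← map_inv, ← map_mul] at h
    rw [SetLike.mem_coe, MonoidHom.mem_ker]
    simpa only [rcomm, ← map_inv, ← map_mul] using h)

section

variable {T : Type*} [Group T] (a b : G →* T)
    (h₁ : ∀ x y z, rconj (rcomm (a x) (b y)) (a z) = rcomm (a (rconj x z)) (b (rconj y z)))
    (h₂ : ∀ x y z, rconj (rcomm (a x) (b y)) (b z) = rcomm (a (rconj x z)) (b (rconj y z)))
    (h₃ : ∀ x, rcomm (a x) (b x) = 1)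

theorem tauLift_tauL (x : G) : tauLift a b h₁ h₂ h₃ (tauL G x) = a x :=
  nuLift_nuL a b h₁ h₂ x

theorem tauLift_tauR (x : G) : tauLift a b h₁ h₂ h₃ (tauR G x) = b x :=
  nuLift_nuR a b h₁ h₂ x

theorem tauLift_wedge (x y : G) :
    tauLift a b h₁ h₂ h₃ (wedge x y : extSq G) = rcomm (a x) (b y) := by
  simp only [wedge, rcomm, map_mul, map_inv, tauLift_tauL, tauLift_tauR]

end

theorem tau_induction {P : Tau G → Prop} (left : ∀ x, P (tauL G x)) (right : ∀ x, P (tauR G x))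
    (mul : ∀ s t, P s → P t → P (s * t)) (t : Tau G) : P t := by
  obtain ⟨t, rfl⟩ := QuotientGroup.mk_surjective t
  obtain ⟨t, rfl⟩ := QuotientGroup.mk_surjective t
  induction t using Monoid.Coprod.induction_on with
  | inl x => exact left x
  | inr x => exact right x
  | mul s t hs ht => exact mul _ _ hs ht

@[simp] theorem extAct_mul (c d : extSq G) (z : G) :
    extAct (c * d) z = extAct c z * extAct d z := by
  apply Subtype.ext
  simp only [extAct, conjIn, rconj, Subgroup.coe_mul]
  group

@[simp] theorem extAct_one_left (z : G) : extAct (1 : extSq G) z = 1 := by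
  apply Subtype.ext
  simp [extAct, conjIn, rconj]

@[simp] theorem extAct_inv (c : extSq G) (z : G) : extAct c⁻¹ z = (extAct c z)⁻¹ := by
  apply Subtype.ext
  simp [extAct, conjIn, rconj, mul_assoc]

@[simp] theorem extAct_one_right (c : extSq G) : extAct c 1 = c := by
  apply Subtype.ext
  simp [extAct, conjIn, rconj]

theorem extAct_mul_right (c : extSq G) (z w : G) :
    extAct c (z * w) = extAct (extAct c z) w := by
  apply Subtype.ext
  simp only [extAct, conjIn, rconj, map_mul]
  group

theorem wedge_tau_right (x y z : G) :
    rconj (wedge x y : Tau G) (tauR G z) = (wedge (rconj x z) (rconj y z) : extSq G) :=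
  congrArg (QuotientGroup.mk' (nabla G)) (nu_rel_right x y z)

theorem wedge_self (x : G) : wedge x x = 1 := by
  apply Subtype.ext
  exact (QuotientGroup.eq_one_iff (N := nabla G) _).2 (Subgroup.subset_closure ⟨x, rfl⟩)

theorem wedge_mul_left (x x' y : G) :
    wedge (x * x') y = extAct (wedge x y) x' * wedge x' y := by
  apply Subtype.ext
  simp only [wedge, extAct, conjIn, rconj, rcomm, Subgroup.coe_mul, map_mul]
  group

theorem wedge_mul_right (x y y' : G) :
    wedge x (y * y') = wedge x y' * extAct (wedge x y) y' := by
  apply Subtype.ext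
  rw [extAct_wedge, Subgroup.coe_mul, ← wedge_tau_right]
  simp only [wedge, rconj, rcomm, map_mul]
  group

/-- The subgroup `D` generated by wedges is stable under conjugation by both copies of `G`, and the
copies commute modulo `D`. So every element of `τ(G)` has the form `g h* d` with `d ∈ D`, and lying
in the kernel forces `g = h = 1`. -/
theorem closure_wedge_eq_top :
    Subgroup.closure (Set.range fun x : G × G => wedge x.1 x.2) = ⊤ := by
  let D : Subgroup (Tau G) :=
    (Subgroup.closure (Set.range fun x : G × G => wedge x.1 x.2)).map (extSq G).subtype
  have hw : ∀ x y : G, (wedge x y : Tau G) ∈ D :=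
    fun x y => ⟨_, Subgroup.subset_closure ⟨(x, y), rfl⟩, rfl⟩
  have hconj : ∀ t : Tau G, (∀ x y : G, rconj (wedge x y : Tau G) t ∈ D) →
      ∀ d ∈ D, rconj d t ∈ D := by
    rintro t ht _ ⟨d, hd, rfl⟩
    induction hd using Subgroup.closure_induction with
    | mem d hd => obtain ⟨x, rfl⟩ := hd; exact ht _ _
    | one => simp [rconj, one_mem]
    | mul a b _ _ ha hb =>
      convert mul_mem ha hb using 1
      simp only [rconj, map_mul]; group
    | inv a _ ha =>
      convert inv_mem ha using 1
      simp only [rconj, map_inv]; group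
  have hL : ∀ z, ∀ d ∈ D, rconj d (tauL G z) ∈ D := fun z => hconj _ fun x y => by
    have : rconj (wedge x y : Tau G) (tauL G z) = (wedge (rconj x z) (rconj y z) : extSq G) :=
      congrArg Subtype.val (extAct_wedge x y z)
    rw [this]; exact hw _ _
  have hR : ∀ z, ∀ d ∈ D, rconj d (tauR G z) ∈ D := fun z => hconj _ fun x y => by
    rw [wedge_tau_right]; exact hw _ _
  have key : ∀ t : Tau G, ∀ g h : G, ∀ d ∈ D,
      ∃ g' h', ∃ d' ∈ D, tauL G g * tauR G h * d * t = tauL G g' * tauR G h' * d' := by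
    intro t
    induction t using tau_induction with
    | left x =>
      intro g h d hd
      -- Moving `x` to the left past `h*` costs the factor `(x ∧ h)⁻¹`.
      refine ⟨g * x, h, _, mul_mem (inv_mem (hw x h)) (hL x d hd), ?_⟩
      simp only [wedge, rcomm, rconj, map_mul]
      group
    | right x =>
      intro g h d hd
      refine ⟨g, h * x, _, hR x d hd, ?_⟩
      simp only [rconj, map_mul]
      group
    | mul s t hs ht =>
      intro g h d hd
      obtain ⟨g', h', d', hd', h₁⟩ := hs g h d hd
      obtain ⟨g'', h'', d'', hd'', h₂⟩ := ht g' h' d' hd'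
      exact ⟨g'', h'', d'', hd'', by rw [← mul_assoc, h₁, h₂]⟩
  rw [eq_top_iff]
  rintro c -
  obtain ⟨g, h, d, hd, hc⟩ := key c 1 1 1 (one_mem _)
  have hcL : ∀ g, cTau G (tauL G g) = (g, 1) := fun g => by simp [cTau, cNu, tauL, nuL]
  have hcR : ∀ g, cTau G (tauR G g) = (1, g) := fun g => by simp [cTau, cNu, tauR, nuR]
  obtain ⟨e, he, rfl⟩ := hd
  rw [map_one, map_one, one_mul, one_mul, one_mul] at hc
  have h₁ := congrArg (cTau G) hc
  have h₂ : cTau G c = 1 := c.2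
  have h₃ : cTau G ((extSq G).subtype e) = 1 := e.2
  rw [h₂, map_mul, h₃, map_mul, hcL, hcR] at h₁
  have h₄ : (1 : G × G) = (g, h) := by simpa using h₁
  rw [Prod.ext_iff] at h₄
  obtain ⟨rfl, rfl⟩ := h₄
  have : c = e := by
    apply Subtype.ext
    simpa using hc
  rwa [this]

theorem extSq_induction {P : extSq G → Prop} (wedge : ∀ x y, P (wedge x y)) (one : P 1)
    (mul : ∀ c d, P c → P d → P (c * d)) (inv : ∀ c, P c → P c⁻¹) (c : extSq G) : P c := by
  have hc : c ∈ Subgroup.closure (Set.range fun x : G × G => LiedtkeK.wedge x.1 x.2) := by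
    rw [closure_wedge_eq_top]; trivial
  induction hc using Subgroup.closure_induction with
  | mem d hd => obtain ⟨x, rfl⟩ := hd; exact wedge _ _
  | one => exact one
  | mul a b _ _ ha hb => exact mul a b ha hb
  | inv a _ ha => exact inv a ha

variable (G) in
/-- The homomorphism `τ(G) → G` which is the identity on both copies of `G`. -/
def tauFold : Tau G →* G :=
  tauLift (MonoidHom.id G) (MonoidHom.id G) (by intros; simp [rconj, rcomm, mul_assoc])
    (by intros; simp [rconj, rcomm, mul_assoc]) (by intros; simp [rcomm])

theorem tauFold_tauL (x : G) : tauFold G (tauL G x) = x :=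
  tauLift_tauL _ _ _ _ _ x

theorem tauFold_tauR (x : G) : tauFold G (tauR G x) = x :=
  tauLift_tauR _ _ _ _ _ x

variable (G) in
/-- The commutator map `G ∧ G → G`, `x ∧ y ↦ [x, y]`. -/
def extBd : extSq G →* G := (tauFold G).comp (extSq G).subtype

theorem extBd_wedge (x y : G) : extBd G (wedge x y) = rcomm x y := by
  change tauFold G (wedge x y : extSq G) = rcomm x y
  rw [tauFold, tauLift_wedge]
  rfl

/-- The relations of `ν(G)` make `z` and `z*` act alike on wedges, so conjugation on `G ∧ G` factors
through the map that folds both copies onto `G`. -/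
theorem conj_eq_extAct (t : Tau G) (c : extSq G) :
    rconj (c : Tau G) t = (extAct c (tauFold G t) : extSq G) := by
  induction t using tau_induction generalizing c with
  | left x => rfl
  | right x =>
    rw [tauFold_tauR]
    induction c using extSq_induction with
    | wedge y z => rw [wedge_tau_right, extAct_wedge]
    | one => simp [rconj]
    | mul a b ha hb => 
      rw [extAct_mul, Subgroup.coe_mul (extSq G) (extAct a x), ← ha, ← hb]
      simp only [Subgroup.coe_mul, rconj]; group
    | inv a ha => 
      rw [extAct_inv, Subgroup.coe_inv (extSq G) (extAct a x), ← ha]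
      simp only [Subgroup.coe_inv, rconj]; group
  | mul s t hs ht =>
    rw [map_mul, extAct_mul_right, ← ht, ← hs]
    simp only [rconj]; group

/-- The Peiffer identity. -/
theorem extAct_extBd (c d : extSq G) : extAct c (extBd G d) = d⁻¹ * c * d :=
  Subtype.ext (conj_eq_extAct (d : Tau G) c).symm

/-- For `c = a ∧ b`, expand `a ∧ (b y)` in two ways, the second through `b y = y^(b⁻¹) b`, and
compare with `a^b ∧ y`, where `a^b = a [a, b]`. Both sides obey the same product rule in `c`, which
extends this to all of `G ∧ G`. -/
theorem wedge_extBd (c : extSq G) (y : G) : wedge (extBd G c) y = c⁻¹ * extAct c y := by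
  have hmul : ∀ c d : extSq G, wedge (extBd G (c * d)) y =
      d⁻¹ * wedge (extBd G c) y * d * wedge (extBd G d) y := by
    intro c d
    rw [map_mul, wedge_mul_left, extAct_extBd]
  have hone : wedge (1 : G) y = 1 := by
    have := wedge_mul_left 1 1 y
    simpa using this
  induction c using extSq_induction with
  | wedge a b =>
    have h₁ : rconj a b = a * extBd G (wedge a b) := by
      simp only [extBd_wedge, rconj, rcomm]; group
    have h₂ := wedge_mul_left a (extBd G (wedge a b)) y
    rw [← h₁, extAct_extBd] at h₂
    have h₃ := wedge_mul_right a b y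
    have h₄ := wedge_mul_right a (rconj y b⁻¹) b
    have h₅ : rconj y b⁻¹ * b = b * y := by simp only [rconj]; group
    have h₆ : rconj (rconj y b⁻¹) b = y := by simp only [rconj]; group
    rw [h₅, h₃, extAct_wedge a (rconj y b⁻¹), h₆, h₂] at h₄
    rw [eq_inv_mul_iff_mul_eq]
    apply mul_left_cancel (a := wedge a y)
    rw [h₄]
    group
  | one => rw [map_one, hone]; simp
  | mul a b ha hb =>
    rw [hmul, ha, hb, extAct_mul]; group
  | inv a ha =>
    have := hmul a a⁻¹
    rw [mul_inv_cancel, map_one, hone, ha] at this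
    rw [extAct_inv]
    rw [eq_comm, mul_eq_one_iff_inv_eq] at this
    rw [← this]
    group

theorem wedge_one_left (y : G) : wedge 1 y = 1 := by
  simpa using wedge_extBd 1 y

theorem wedge_one_right (x : G) : wedge x 1 = 1 := by
  simpa using wedge_mul_right x 1 1

/-- Expanding `(x y) ∧ (x y) = 1` leaves this product acted on by `y`. -/
theorem wedge_mul_wedge_swap (x y : G) : wedge x y * wedge y x = 1 := by
  have h := wedge_self (x * y)
  rw [wedge_mul_left, wedge_mul_right x, wedge_mul_right y, wedge_self, wedge_self,
    extAct_one_left, mul_one, one_mul, ← extAct_mul] at h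
  have h₁ := congrArg (fun c => extAct c y⁻¹) h
  simpa [← extAct_mul_right] using h₁

theorem wedge_swap (x y : G) : wedge y x = (wedge x y)⁻¹ :=
  (inv_eq_of_mul_eq_one_right (wedge_mul_wedge_swap x y)).symm

/-- In this form the first factor moves the left entry instead of acting on the wedge, which is what
makes `twist` an action of `G`. -/
theorem wedge_mul_right' (e x y : G) :
    wedge e (x * y) = wedge e x * wedge (rconj e x) y := by
  have h₁ : rconj e x = e * extBd G (wedge e x) := by
    simp only [extBd_wedge, rconj, rcomm]; group
  rw [h₁, wedge_mul_left, wedge_extBd, extAct_extBd, wedge_mul_right]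
  group

/-- Used in `WedgeExt.adjoin`: the powers of an adjoined lift commute, so their wedges must vanish.
-/
theorem wedge_zpow_zpow (x : G) (m n : ℤ) : wedge (x ^ m) (x ^ n) = 1 := by
  have hright : ∀ y z : G, wedge y z = 1 → ∀ n : ℤ, wedge y (z ^ n) = 1 := by
    intro y z hz n
    have hmul : ∀ a b : G, wedge y a = 1 → wedge y b = 1 → wedge y (a * b) = 1 := by
      intro a b ha hb
      rw [wedge_mul_right, ha, hb, extAct_one_left, one_mul]
    have hinv : wedge y z⁻¹ = 1 := by
      have := wedge_mul_right y z z⁻¹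
      rwa [mul_inv_cancel, wedge_one_right, hz, extAct_one_left, mul_one, eq_comm] at this
    induction n using Int.induction_on with
    | zero => rw [zpow_zero, wedge_one_right]
    | succ i ih => rw [zpow_add_one]; exact hmul _ _ ih hz
    | pred i ih => rw [zpow_sub_one]; exact hmul _ _ ih hinv
  refine hright _ _ ?_ n
  rw [wedge_swap, hright _ _ (wedge_self x), inv_one]

end Tau

/-! ### A central extension with commutator subgroup `G ∧ G` -/

/-- An extension of a subgroup of `G` which contains `G ∧ G` and in which commutators are given by
wedges. -/
structure WedgeExt (G E : Type*) [Group G] [Group E] where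
  /-- The inclusion of `G ∧ G`. -/
  j : extSq G →* E
  /-- The map to `G`. -/
  δ : E →* G
  j_injective : Function.Injective j
  δ_j : ∀ c, δ (j c) = extBd G c
  rconj_j : ∀ c e, rconj (j c) e = j (extAct c (δ e))
  rcomm_eq : ∀ e e', rcomm e e' = j (wedge (δ e) (δ e'))

namespace WedgeExt

variable {G E : Type*} [Group G] [Group E]

variable (G) in
/-- The crossed module `G ∧ G → G`. -/
def base : WedgeExt G (extSq G) where
  j := MonoidHom.id _
  δ := extBd G
  j_injective := Function.injective_id
  δ_j _ := rfl
  rconj_j c e := (extAct_extBd c e).symm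
  rcomm_eq e e' := by
    rw [wedge_extBd, extAct_extBd]
    simp only [rcomm, MonoidHom.id_apply]
    group

variable (S : WedgeExt G E)

theorem mul_j_comm (e : E) (c : extSq G) : S.j c * e = e * S.j (extAct c (S.δ e)) := by
  rw [← S.rconj_j, rconj]
  group

/-- The endomorphism `e ↦ e (δ e ∧ x)`, by which `x ∈ G` acts on the right. -/
def twist (x : G) : E →* E :=
  MonoidHom.mk' (fun e => e * S.j (wedge (S.δ e) x)) (by
    intro a b
    have h := S.mul_j_comm b (wedge (S.δ a) x)
    rw [map_mul, wedge_mul_left, map_mul, mul_assoc a (S.j _), ← mul_assoc (S.j _) b, h]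
    simp only [mul_assoc])

theorem twist_apply (x : G) (e : E) : S.twist x e = e * S.j (wedge (S.δ e) x) := rfl

theorem δ_twist (x : G) (e : E) : S.δ (S.twist x e) = rconj (S.δ e) x := by
  rw [twist_apply, map_mul, S.δ_j, extBd_wedge, rcomm, rconj]
  group

theorem twist_twist (x y : G) (e : E) : S.twist y (S.twist x e) = S.twist (x * y) e := by
  rw [twist_apply _ y, δ_twist, twist_apply, twist_apply, wedge_mul_right', map_mul, mul_assoc]

theorem twist_one (e : E) : S.twist 1 e = e := by
  rw [twist_apply, wedge_one_right, map_one, mul_one]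

theorem twist_j (x : G) (c : extSq G) : S.twist x (S.j c) = S.j (extAct c x) := by
  rw [twist_apply, S.δ_j, wedge_extBd, ← map_mul, mul_inv_cancel_left]

/-- The action of `G` on `E` by twists, as a left action. -/
noncomputable def twistAut : G →* MulAut E where
  toFun x := MulEquiv.ofBijective (S.twist x⁻¹) (Function.bijective_iff_has_inverse.2
    ⟨S.twist x, fun e => by rw [twist_twist, inv_mul_cancel, twist_one],
      fun e => by rw [twist_twist, mul_inv_cancel, twist_one]⟩)
  map_one' := by
    ext e
    change S.twist 1⁻¹ e = e
    rw [inv_one, twist_one]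
  map_mul' x y := by
    ext e
    change S.twist (x * y)⁻¹ e = S.twist x⁻¹ (S.twist y⁻¹ e)
    rw [twist_twist, mul_inv_rev]

/-- The extension `E ⋊ ⟨x⟩` obtained by adjoining a lift of `x`. -/
abbrev Adjoin (x : G) : Type _ := E ⋊[S.twistAut.comp (zpowersHom G x)] Multiplicative ℤ

/-- The map `E ⋊ ⟨x⟩ → G`. -/
noncomputable def adjoinδ (x : G) : S.Adjoin x →* G :=
  SemidirectProduct.lift S.δ (zpowersHom G x) (by
    intro n
    ext e
    change S.δ (S.twist _ e) = zpowersHom G x n * S.δ e * (zpowersHom G x n)⁻¹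
    rw [δ_twist, rconj, inv_inv])

theorem rcomm_mul_left {E' : Type*} [Group E'] (a b c : E') :
    rcomm (a * b) c = rconj (rcomm a c) b * rcomm b c := by
  simp only [rcomm, rconj]
  group

theorem rcomm_mul_right {E' : Type*} [Group E'] (a b c : E') :
    rcomm a (b * c) = rcomm a c * rconj (rcomm a b) c := by
  simp only [rcomm, rconj]
  group

/-- Adjoining a lift of `x` to an extension of the given type. -/
noncomputable def adjoin (x : G) : WedgeExt G (S.Adjoin x) :=
  have hδl : ∀ e, S.adjoinδ x (.inl e) = S.δ e := fun e => by simp [adjoinδ]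
  have hδr : ∀ n, S.adjoinδ x (.inr n) = zpowersHom G x n := fun n => by
    simp [adjoinδ, SemidirectProduct.lift]
  have hconj : ∀ e n, rconj (SemidirectProduct.inl e : S.Adjoin x) (.inr n) =
      .inl (S.twist (zpowersHom G x n) e) := by
    intro e n
    have h := SemidirectProduct.inl_aut_inv (φ := S.twistAut.comp (zpowersHom G x)) n e
    rw [rconj, ← map_inv, ← h, ← map_inv]
    congr 1
    change S.twist (zpowersHom G x n⁻¹)⁻¹ e = _
    rw [map_inv, inv_inv]
  have hj : ∀ c e, rconj ((SemidirectProduct.inl.comp S.j) c : S.Adjoin x) e =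
      (SemidirectProduct.inl.comp S.j) (extAct c (S.adjoinδ x e)) := by
    intro c e
    rw [← SemidirectProduct.inl_left_mul_inr_right e, map_mul, hδl, hδr, extAct_mul_right]
    have h : ∀ a b d : S.Adjoin x, rconj a (b * d) = rconj (rconj a b) d := by
      intro a b d
      simp only [rconj]
      group
    rw [h]
    have h₁ : rconj ((SemidirectProduct.inl.comp S.j) c : S.Adjoin x) (.inl e.left) =
        .inl (S.j (extAct c (S.δ e.left))) := by
      rw [← S.rconj_j]
      simp [rconj]
    rw [h₁, hconj, twist_j]
    rfl
  -- Commutators and wedges expand over products by the same rules, so `rcomm_eq` need only be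
  -- checked on the two factors of the semidirect product.
  have hleft : ∀ a b c, rcomm a c = (SemidirectProduct.inl.comp S.j)
        (wedge (S.adjoinδ x a) (S.adjoinδ x c)) →
      rcomm b c = (SemidirectProduct.inl.comp S.j) (wedge (S.adjoinδ x b) (S.adjoinδ x c)) →
      rcomm (a * b) c = (SemidirectProduct.inl.comp S.j)
        (wedge (S.adjoinδ x (a * b)) (S.adjoinδ x c)) := by
    intro a b c ha hb
    rw [rcomm_mul_left, ha, hb, hj, map_mul (S.adjoinδ x), wedge_mul_left, map_mul]
  have hright : ∀ a b c, rcomm a b = (SemidirectProduct.inl.comp S.j)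
        (wedge (S.adjoinδ x a) (S.adjoinδ x b)) →
      rcomm a c = (SemidirectProduct.inl.comp S.j) (wedge (S.adjoinδ x a) (S.adjoinδ x c)) →
      rcomm a (b * c) = (SemidirectProduct.inl.comp S.j)
        (wedge (S.adjoinδ x a) (S.adjoinδ x (b * c))) := by
    intro a b c hb hc
    rw [rcomm_mul_right, hb, hc, hj, map_mul (S.adjoinδ x), wedge_mul_right, map_mul]
  have hll : ∀ a b, rcomm (SemidirectProduct.inl a : S.Adjoin x) (.inl b) =
      (SemidirectProduct.inl.comp S.j) (wedge (S.adjoinδ x (.inl a)) (S.adjoinδ x (.inl b))) := by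
    intro a b
    rw [hδl, hδl, MonoidHom.comp_apply, ← S.rcomm_eq]
    simp [rcomm]
  have hlr : ∀ a n, rcomm (SemidirectProduct.inl a : S.Adjoin x) (.inr n) =
      (SemidirectProduct.inl.comp S.j) (wedge (S.adjoinδ x (.inl a)) (S.adjoinδ x (.inr n))) := by
    intro a n
    have h : rcomm (SemidirectProduct.inl a : S.Adjoin x) (.inr n) =
        .inl a⁻¹ * rconj (SemidirectProduct.inl a) (.inr n) := by
      simp only [rcomm, rconj, map_inv]
      group
    -- The twist is designed for this: `e⁻¹` times the twist of `e` is the required wedge.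
    rw [h, hconj, hδl, hδr, ← map_mul, twist_apply, inv_mul_cancel_left]
    rfl
  have hrl : ∀ n a, rcomm (SemidirectProduct.inr n : S.Adjoin x) (.inl a) =
      (SemidirectProduct.inl.comp S.j) (wedge (S.adjoinδ x (.inr n)) (S.adjoinδ x (.inl a))) := by
    intro n a
    rw [wedge_swap, map_inv, ← hlr]
    simp only [rcomm]
    group
  have hrr : ∀ n m, rcomm (SemidirectProduct.inr n : S.Adjoin x) (.inr m) =
      (SemidirectProduct.inl.comp S.j) (wedge (S.adjoinδ x (.inr n)) (S.adjoinδ x (.inr m))) := by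
    intro n m
    rw [hδr, hδr, zpowersHom_apply, zpowersHom_apply, wedge_zpow_zpow, map_one]
    simp only [rcomm, ← map_inv, ← map_mul]
    rw [← map_one SemidirectProduct.inr]
    congr 1
    rw [mul_right_comm, inv_mul_cancel_right, inv_mul_cancel]
  { j := SemidirectProduct.inl.comp S.j
    δ := S.adjoinδ x
    j_injective := SemidirectProduct.inl_injective.comp S.j_injective
    δ_j := fun c => (hδl _).trans (S.δ_j c)
    rconj_j := hj
    rcomm_eq := by
      intro e e'
      rw [← SemidirectProduct.inl_left_mul_inr_right e,
        ← SemidirectProduct.inl_left_mul_inr_right e']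
      exact hleft _ _ _ (hright _ _ _ (hll _ _) (hlr _ _)) (hright _ _ _ (hrl _ _) (hrr _ _)) }

theorem range_δ_le_adjoin (x : G) : S.δ.range ≤ (S.adjoin x).δ.range := by
  rintro _ ⟨e, rfl⟩
  exact ⟨.inl e, by simp [adjoin, adjoinδ]⟩

theorem mem_range_δ_adjoin (x : G) : x ∈ (S.adjoin x).δ.range :=
  ⟨.inr (.ofAdd 1), by
    change S.adjoinδ x _ = x
    simp [adjoinδ, SemidirectProduct.lift]⟩

end WedgeExt

/-- For finite `G` there is a central extension of `G` containing `G ∧ G` as its commutator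
subgroup. -/
theorem exists_wedgeExt (G : Type u) [Group G] [Finite G] :
    ∃ (E : Type u) (_ : Group E) (S : WedgeExt G E), Function.Surjective S.δ := by
  have key : ∀ s : Set G, s.Finite →
      ∃ (E : Type u) (_ : Group E) (S : WedgeExt G E), s ⊆ S.δ.range := by
    intro s hs
    induction s, hs using Set.Finite.induction_on with
    | empty => exact ⟨_, _, WedgeExt.base G, Set.empty_subset _⟩
    | insert _ _ ih =>
      obtain ⟨E, _, S, hS⟩ := ih
      exact ⟨_, _, S.adjoin _, Set.insert_subset (S.mem_range_δ_adjoin _)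
        (hS.trans (S.range_δ_le_adjoin _))⟩
  obtain ⟨E, i, S, hS⟩ := key Set.univ Set.finite_univ
  exact ⟨E, i, S, fun g => hS (Set.mem_univ g)⟩

/-- For `e` in the kernel, `[e, f]` is the image of `1 ∧ δ f = 1`. -/
theorem WedgeExt.ker_δ_le_center {G E : Type*} [Group G] [Group E] (S : WedgeExt G E) :
    S.δ.ker ≤ Subgroup.center E := by
  intro e he
  rw [Subgroup.mem_center_iff]
  intro f
  have h := S.rcomm_eq e f
  rw [he, wedge_one_left, map_one, rcomm, mul_assoc, ← mul_inv_rev, inv_mul_eq_one] at h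
  exact h

/-! ### The exterior square and the commutator subgroup of a Schur cover -/

theorem exists_factor {H G T : Type*} [Group H] [Group G] [Group T] (π : H →* G)
    (hπ : Function.Surjective π) (f : H →* T) (hf : π.ker ≤ f.ker) :
    ∃ a : G →* T, ∀ x, a (π x) = f x :=
  ⟨π.liftOfSurjective hπ ⟨f, hf⟩, fun x => MonoidHom.liftOfRightInverse_comp_apply _ _ _ ⟨f, hf⟩ x⟩

theorem rcomm_eq_commutatorElement {H : Type*} [Group H] (x y : H) : rcomm x y = ⁅x⁻¹, y⁻¹⁆ := by
  simp [rcomm, commutatorElement_def]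

theorem rcomm_mem_commutator {H : Type*} [Group H] (x y : H) : rcomm x y ∈ commutator H := by
  rw [rcomm_eq_commutatorElement, commutator_def]
  exact Subgroup.commutator_mem_commutator trivial trivial

/-- Triples `(a, a c, c)` with `a, c` in the kernel of a homomorphism with central kernel. -/
def kerTriples {H G : Type*} [Group H] [Group G] (π : H →* G)
    (hπ : π.ker ≤ Subgroup.center H) : Subgroup (H × H × H) where
  carrier := {x | π x.1 = 1 ∧ π x.2.2 = 1 ∧ x.2.1 = x.1 * x.2.2}
  one_mem' := by simp
  mul_mem' := by
    rintro x y ⟨h₁, h₂, h₃⟩ ⟨k₁, k₂, k₃⟩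
    refine ⟨by simp [h₁, k₁], by simp [h₂, k₂], ?_⟩
    have := Subgroup.mem_center_iff.1 (hπ h₂) y.1
    simp only [Prod.fst_mul, Prod.snd_mul, h₃, k₃]
    rw [mul_assoc, ← mul_assoc x.2.2, ← this]
    simp only [mul_assoc]
  inv_mem' := by
    rintro x ⟨h₁, h₂, h₃⟩
    refine ⟨by simp [h₁], by simp [h₂], ?_⟩
    have := Subgroup.mem_center_iff.1 (hπ h₂) x.1
    simp only [Prod.fst_inv, Prod.snd_inv, h₃, ← mul_inv_rev, this]

instance kerTriples_normal {H G : Type*} [Group H] [Group G] (π : H →* G)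
    (hπ : π.ker ≤ Subgroup.center H) : (kerTriples π hπ).Normal where
  conj_mem := by
    rintro x ⟨h₁, h₂, h₃⟩ g
    have c₁ := hπ h₁
    have c₂ := hπ h₂
    have c₃ := mul_mem c₁ c₂
    rw [← h₃] at c₃
    rw [Subgroup.mem_center_iff] at c₁ c₂ c₃
    have : g * x * g⁻¹ = x := by
      rw [mul_inv_eq_iff_eq_mul]
      ext
      · exact c₁ _
      · exact c₃ _
      · exact c₂ _
    rw [this]
    exact ⟨h₁, h₂, h₃⟩

/-- The commutator pairing of a central extension of `G`, as a homomorphism on `G ∧ G`. -/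
theorem exists_extSq_hom {H G : Type*} [Group H] [Group G] (π : H →* G)
    (hs : Function.Surjective π) (hπ : π.ker ≤ Subgroup.center H) :
    ∃ θ : extSq G →* commutator H, ∀ x y, (θ (wedge (π x) (π y)) : H) = rcomm x y := by
  -- A target for `τ(G)` is needed in which the copies of `G` do not commute. Modulo `C` the triples
  -- `(h, h, 1)` and `(1, h, h)` depend only on `π h`; the commutator of two such triples is `(1,
  -- [x, y], 1)`, and `C` meets the middle factor trivially, so `[x, y]` can be recovered.
  let C := kerTriples π hπ
  let m := QuotientGroup.mk' C
  let fa : H →* H × H × H :=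
    MonoidHom.mk' (fun h => (h, h, 1)) (by intro x y; simp)
  let fb : H →* H × H × H :=
    MonoidHom.mk' (fun h => (1, h, h)) (by intro x y; simp)
  let fc : H →* H × H × H :=
    MonoidHom.mk' (fun h => (1, h, 1)) (by intro x y; simp)
  obtain ⟨a, ha⟩ := exists_factor π hs (m.comp fa) (by
    intro x hx
    exact (QuotientGroup.eq_one_iff _).2 ⟨hx, map_one π, (mul_one x).symm⟩)
  obtain ⟨b, hb⟩ := exists_factor π hs (m.comp fb) (by
    intro x hx
    exact (QuotientGroup.eq_one_iff _).2 ⟨map_one π, hx, (one_mul x).symm⟩)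
  have hab : ∀ x y, rcomm (a (π x)) (b (π y)) = m (fc (rcomm x y)) := by
    intro x y
    rw [ha, hb]
    simp only [rcomm, MonoidHom.comp_apply, ← map_inv, ← map_mul]
    congr 1
    simp [fa, fb, fc]
  have hr : ∀ x z, rconj (π x) (π z) = π (rconj x z) := by
    intro x z
    simp [rconj]
  let Θ : Tau G →* (H × H × H) ⧸ C := tauLift a b
    (by
      intro x y z
      obtain ⟨x, rfl⟩ := hs x
      obtain ⟨y, rfl⟩ := hs y
      obtain ⟨z, rfl⟩ := hs z
      rw [hr, hr, hab, hab, ha, rconj]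
      simp only [MonoidHom.comp_apply, ← map_inv, ← map_mul]
      congr 1
      simp only [fa, fc, MonoidHom.mk'_apply, Prod.mk_mul_mk, rcomm, rconj]
      ext <;> simp [mul_assoc])
    (by
      intro x y z
      obtain ⟨x, rfl⟩ := hs x
      obtain ⟨y, rfl⟩ := hs y
      obtain ⟨z, rfl⟩ := hs z
      rw [hr, hr, hab, hab, hb, rconj]
      simp only [MonoidHom.comp_apply, ← map_inv, ← map_mul]
      congr 1
      simp only [fb, fc, MonoidHom.mk'_apply, Prod.mk_mul_mk, rcomm, rconj]
      ext <;> simp [mul_assoc])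
    (by
      intro x
      obtain ⟨x, rfl⟩ := hs x
      rw [hab]
      simp [rcomm])
  have hΘ : ∀ x y, Θ (wedge (π x) (π y) : extSq G) = m (fc (rcomm x y)) := by
    intro x y
    rw [← hab]
    exact tauLift_wedge _ _ _ _ _ _ _
  have hinj : Function.Injective (m.comp fc) := by
    rw [injective_iff_map_eq_one]
    intro x hx
    have h : fc x ∈ C := (QuotientGroup.eq_one_iff _).1 hx
    obtain ⟨-, -, h⟩ := h
    simpa [fc] using h
  have hex : ∀ c : extSq G, ∃ h : commutator H, m (fc h) = Θ c := by
    intro c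
    induction c using extSq_induction with
    | wedge x y =>
      obtain ⟨x, rfl⟩ := hs x
      obtain ⟨y, rfl⟩ := hs y
      exact ⟨⟨_, rcomm_mem_commutator x y⟩, (hΘ x y).symm⟩
    | one => exact ⟨1, by simp⟩
    | mul c d hc hd =>
      obtain ⟨x, hx⟩ := hc
      obtain ⟨y, hy⟩ := hd
      exact ⟨x * y, by simp only [Subgroup.coe_mul, map_mul, hx, hy]⟩
    | inv c hc =>
      obtain ⟨x, hx⟩ := hc
      exact ⟨x⁻¹, by simp only [Subgroup.coe_inv, map_inv, hx]⟩
  choose θ hθ using hex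
  refine ⟨MonoidHom.mk' θ fun c d => ?_, fun x y => ?_⟩
  · apply Subtype.ext
    apply hinj
    change m (fc _) = m (fc _)
    rw [hθ, Subgroup.coe_mul, Subgroup.coe_mul, map_mul, map_mul, map_mul, hθ, hθ]
  · apply hinj
    change m (fc (θ _)) = m (fc _)
    rw [hθ, hΘ]

/-- Surjectivity holds for any central extension. Injectivity compares `H` with the extension from
`exists_wedgeExt` and is where the maximality of the Schur cover enters, through
`mem_ker_commutator`. -/
theorem IsSchurCover.exists_extSq_equiv {H : Type v} {G : Type u} [Group H] [Group G]
    [Finite G] {π : H →* G} (h : IsSchurCover π) :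
    ∃ θ : extSq G ≃* commutator H,
      (∀ x y : H, (θ (wedge (π x) (π y)) : H) = rcomm x y) ∧
      ∀ (c : extSq G) (x : H), θ (extAct c (π x)) = conjIn (commutator H) (θ c) x := by
  obtain ⟨θ, hθ⟩ := exists_extSq_hom π h.surjective h.ker_le_center
  have hact : ∀ (c : extSq G) (x : H), θ (extAct c (π x)) = conjIn (commutator H) (θ c) x := by
    intro c x
    apply Subtype.ext
    change _ = rconj (θ c : H) x
    induction c using extSq_induction with
    | wedge y z =>
      obtain ⟨y, rfl⟩ := h.surjective y
      obtain ⟨z, rfl⟩ := h.surjective z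
      have hr : ∀ y z, rconj (π y) (π z) = π (rconj y z) := by
        intro y z
        simp [rconj]
      rw [extAct_wedge, hr, hr, hθ, hθ]
      simp only [rcomm, rconj]
      group
    | one => simp [rconj]
    | mul c d hc hd =>
      simp only [extAct_mul, map_mul, Subgroup.coe_mul, hc, hd, rconj]
      group
    | inv c hc =>
      simp only [extAct_inv, map_inv, Subgroup.coe_inv, hc, rconj]
      group
  have hsurj : Function.Surjective θ := by
    have key : commutator H ≤ θ.range.map (commutator H).subtype := by
      refine (commutator_def H).le.trans (Subgroup.commutator_le.2 ?_)
      intro x _ y _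
      refine ⟨_, ⟨wedge (π x⁻¹) (π y⁻¹), rfl⟩, ?_⟩
      rw [Subgroup.subtype_apply, hθ, rcomm_eq_commutatorElement, inv_inv, inv_inv]
    rintro ⟨z, hz⟩
    obtain ⟨_, ⟨c, rfl⟩, hc⟩ := key hz
    exact ⟨c, Subtype.ext hc⟩
  obtain ⟨E, _, S, hS⟩ := exists_wedgeExt G
  let p : FreeGroup G →* G := FreeGroup.lift id
  have hp : Function.Surjective p := fun g => ⟨.of g, by simp [p]⟩
  obtain ⟨q, hq⟩ := exists_lift_of_surjective π h.surjective p
  obtain ⟨r, hr⟩ := exists_lift_of_surjective S.δ hS p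
  -- On `F'` the lifts to `E` and to `H` come from a common element of `G ∧ G`, because both send a
  -- commutator to the same wedge.
  have hcomm : ∀ x ∈ commutator (FreeGroup G), ∃ c, S.j c = r x ∧ (θ c : H) = q x := by
    intro x hx
    rw [commutator_eq_closure] at hx
    induction hx using Subgroup.closure_induction with
    | mem x hx =>
      obtain ⟨a, b, rfl⟩ := hx
      refine ⟨wedge (p a⁻¹) (p b⁻¹), ?_, ?_⟩
      · rw [← hr, ← hr, ← S.rcomm_eq, rcomm_eq_commutatorElement, map_commutatorElement]
        simp
      · rw [← hq, ← hq, hθ, rcomm_eq_commutatorElement, map_commutatorElement]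
        simp
    | one => exact ⟨1, by simp⟩
    | mul x y _ _ hx hy =>
      obtain ⟨c, h₁, h₂⟩ := hx
      obtain ⟨d, h₃, h₄⟩ := hy
      exact ⟨c * d, by simp [h₁, h₃], by simp [h₂, h₄]⟩
    | inv x _ hx =>
      obtain ⟨c, h₁, h₂⟩ := hx
      exact ⟨c⁻¹, by simp [h₁], by simp [h₂]⟩
  have hj : ∀ c, S.j c ∈ commutator E := by
    intro c
    induction c using extSq_induction with
    | wedge x y =>
      obtain ⟨x, rfl⟩ := hS x
      obtain ⟨y, rfl⟩ := hS y
      rw [← S.rcomm_eq]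
      exact rcomm_mem_commutator x y
    | one => rw [map_one]; exact one_mem _
    | mul c d hc hd => rw [map_mul]; exact mul_mem hc hd
    | inv c hc => rw [map_inv]; exact inv_mem hc
  have hinj : Function.Injective θ := by
    rw [injective_iff_map_eq_one]
    intro c hc
    have h₁ := hj c
    rw [← map_commutator_eq_of_lift S.δ S.ker_δ_le_center p hp r hr] at h₁
    obtain ⟨x, hx, hxc⟩ := h₁
    obtain ⟨d, hd₁, hd₂⟩ := hcomm x hx
    obtain rfl : d = c := S.j_injective (hd₁.trans hxc)
    rw [hc] at hd₂
    have hx₁ := h.mem_ker_commutator p hp q hq hx hd₂.symm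
    have hx₂ := map_eq_one_of_mem_ker_commutator p r
      (fun y hy => S.ker_δ_le_center ((hr y).trans hy)) hx₁
    apply S.j_injective
    rw [hd₁, hx₂, map_one]
  exact ⟨MulEquiv.ofBijective θ ⟨hinj, hsurj⟩, hθ, hact⟩

/-- `μ` depends only on the entries modulo the centre. -/
theorem mu_eq_of_powMap_eq {H G : Type*} [Group H] [Group G] (π : H →* G)
    (hπ : π.ker ≤ Subgroup.center H) {m : ℕ} {g h g' h' : Fin m → H}
    (hg : powMap π m g = powMap π m g') (hh : powMap π m h = powMap π m h') :
    mu g h = mu g' h' := by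
  have key : ∀ {a b : Fin m → H}, powMap π m a = powMap π m b →
      ∃ z, a = b * z ∧ ∀ i, z i ∈ Subgroup.center H := by
    intro a b hab
    refine ⟨b⁻¹ * a, by simp, fun i => hπ ?_⟩
    have : π (a i) = π (b i) := congrFun hab i
    simp [MonoidHom.mem_ker, this]
  obtain ⟨z, rfl, hz⟩ := key hg
  obtain ⟨w, rfl, hw⟩ := key hh
  apply Subtype.ext
  simp only [mu]
  have h₁ : g' * z * (h' * w) = g' * h' * z * w := by
    funext i
    have := Subgroup.mem_center_iff.1 (hz i) (h' i)
    simp only [Pi.mul_apply]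
    rw [mul_assoc (g' i), ← mul_assoc (z i), ← this]
    simp only [mul_assoc]
  obtain ⟨e₁, c₁⟩ := tupleProd_mul_of_mem_center g' z hz
  obtain ⟨e₂, c₂⟩ := tupleProd_mul_of_mem_center h' w hw
  rw [h₁, (tupleProd_mul_of_mem_center _ w hw).1, (tupleProd_mul_of_mem_center _ z hz).1, e₁, e₂]
  have c₁' := Subgroup.mem_center_iff.1 (inv_mem c₁)
  have c₂' := Subgroup.mem_center_iff.1 (inv_mem c₂)
  calc _ = tupleProd (g' * h') * tupleProd z * (tupleProd w * (tupleProd z)⁻¹) *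
        ((tupleProd g')⁻¹ * (tupleProd w)⁻¹) * (tupleProd h')⁻¹ := by group
    _ = _ := by rw [c₁', c₂']; group

/-! ### The structure of `K̃(G, n)` -/

theorem conjIn_eq_tconj {H : Type*} [Group H] {m : ℕ} (c : commutator H) (h : Fin m → H) :
    conjIn (commutator H) c (tupleProd h)⁻¹ = tconj c h := rfl

/-- Coordinates on `K(F, n)` are the images in `G` of all entries but the last, and the total
product pushed to `H'` and pulled back along `θ`. The multiplication rule is that of a) for `H`. -/
theorem isoExplicitExtension_KTilde {X : Type*} {H : Type v} {G : Type u} [Group H] [Group G]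
    [Finite G] {π : H →* G} (h : IsSchurCover π) (θ : extSq G ≃* commutator H)
    (hθ : ∀ (c : extSq G) (x : H), θ (extAct c (π x)) = conjIn (commutator H) (θ c) x)
    {m : ℕ} (hm : 1 ≤ m) (γ : (Fin m → G) → (Fin m → G) → extSq G)
    (hγ : ∀ g' h' : Fin m → H, θ (γ (powMap π m g') (powMap π m h')) = mu g' h')
    (p : FreeGroup X →* G) (hp : Function.Surjective p) :
    IsoExplicitExtension (KTilde p (m + 1)) (Fin m → G) (extSq G) γ extTconj := by
  obtain ⟨q, hq⟩ := exists_lift_of_surjective π h.surjective p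
  let k : K (FreeGroup X) (m + 1) → K H (m + 1) := KMap q (m + 1)
  have hlift : ∀ g : Fin m → G, ∃ g' : Fin m → FreeGroup X, powMap p m g' = g := by
    intro g
    choose s hs using hp
    exact ⟨fun i => s (g i), funext fun i => hs _⟩
  have hpq : ∀ g : Fin m → FreeGroup X, powMap π m (powMap q m g) = powMap p m g :=
    fun g => funext fun i => hq _
  have hk : ∀ x, tupleProd (k x).1 = q (tupleProd x.1) := fun x => tupleProd_powMap q x.1
  refine isoExplicitExtension_of_surjective (QuotientGroup.mk' _) (QuotientGroup.mk'_surjective _)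
    (fun x => ⟨powMap p m (Fin.init x.1), θ.symm ⟨tupleProd (k x).1, (k x).2⟩⟩) ?_ ?_ ?_ ?_ ?_
  · rintro ⟨g, c⟩
    obtain ⟨g, rfl⟩ := hlift g
    obtain ⟨d, hd, hdc⟩ : (θ c : H) ∈ (commutator (FreeGroup X)).map q :=
      (map_commutator_eq_of_lift π h.ker_le_center p hp q hq).symm ▸ (θ c).2
    refine ⟨⟨_, snoc_mem_K g ⟨d, hd⟩⟩, PairSet.ext ?_ ?_⟩
    · simp
    · change θ.symm _ = c
      rw [MulEquiv.symm_apply_eq]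
      apply Subtype.ext
      change tupleProd (k _).1 = _
      rw [hk, ← hdc, tupleProd_eq_init_mul]
      simp
  · intro x y
    refine PairSet.ext ?_ ?_
    · exact map_mul (powMap p m) (Fin.init x.1) (Fin.init y.1)
    · change θ.symm _ = γ (powMap p m (Fin.init x.1)) (powMap p m (Fin.init y.1)) *
        extTconj (θ.symm _) (powMap p m (Fin.init y.1)) * θ.symm _
      rw [MulEquiv.symm_apply_eq, map_mul, map_mul, ← hpq, ← hpq, hγ, extTconj, tupleProd_powMap π,
        ← map_inv, hθ, θ.apply_symm_apply, θ.apply_symm_apply, conjIn_eq_tconj]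
      have hxy : k (x * y) = k x * k y := map_mul (KMap q (m + 1)) x y
      simp only [hxy]
      exact (mu_mul_tconj_mul (k x) (k y)).symm
  · intro g
    obtain ⟨g, rfl⟩ := hlift g
    apply θ.injective
    have h₁ := hγ (powMap q m g) 1
    rwa [map_one, hpq, mu_one_right, ← map_one θ] at h₁
  · intro c
    rw [extTconj, tupleProd_one, inv_one, extAct_one_right]
  · intro x
    rw [QuotientGroup.mk'_apply, QuotientGroup.eq_one_iff, mem_KRel p hm, PairSet.ext_iff]
    have h₁ : θ.symm ⟨tupleProd (k x).1, (k x).2⟩ = 1 ↔ q (tupleProd x.1) = 1 := by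
      rw [MulEquiv.symm_apply_eq, map_one, ← hk]
      exact Subtype.ext_iff
    constructor
    · rintro ⟨h₂, h₃⟩
      have h₃ := h₁.1 h₃
      refine ⟨fun i => ?_, h.mem_ker_commutator p hp q hq x.2 h₃⟩
      induction i using Fin.lastCases with
      | cast i => exact congrFun h₂ i
      | last =>
        -- The total product and the product of the first `m` entries are trivial in `G`, hence so
        -- is the last entry.
        have h₄ := congrArg π h₃
        have h₅ : p (tupleProd (Fin.init x.1)) = 1 := by
          rw [← tupleProd_powMap]
          exact (congrArg tupleProd h₂).trans tupleProd_one
        rw [hq, map_one, tupleProd_eq_init_mul, map_mul, h₅, one_mul] at h₄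
        exact h₄
    · rintro ⟨h₂, h₃⟩
      refine ⟨funext fun i => h₂ _, h₁.2 ?_⟩
      exact map_eq_one_of_mem_ker_commutator p q
        (fun y hy => h.ker_le_center ((hq y).trans hy)) h₃

/-! ### The central extension of `K(G, n)` by `H₂(G, ℤ)` -/

theorem KTilde_mk_eq {F G : Type*} [Group F] [Group G] (p : F →* G) {m : ℕ} (hm : 1 ≤ m)
    {x y : K F (m + 1)} (h : ∀ i, p (x.1 i) = p (y.1 i))
    (h' : QuotientGroup.mk' ⁅p.ker, (⊤ : Subgroup F)⁆ (tupleProd x.1) =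
      QuotientGroup.mk' _ (tupleProd y.1)) : (QuotientGroup.mk x : KTilde p (m + 1)) =
      QuotientGroup.mk y := by
  obtain ⟨r, rfl⟩ : ∃ r, y = x * r := ⟨x⁻¹ * y, by simp⟩
  have hr : ∀ i, p (r.1 i) = 1 := by
    intro i
    have h₁ : p (x.1 i) = p (x.1 i * r.1 i) := h i
    rwa [map_mul, left_eq_mul] at h₁
  rw [Subgroup.coe_mul, mk_tupleProd_mul p _ _ hr, left_eq_mul] at h'
  rw [QuotientGroup.mk_mul, left_eq_mul, QuotientGroup.eq_one_iff, mem_KRel p hm]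
  exact ⟨hr, (QuotientGroup.eq_one_iff _).1 h'⟩

/-- The central extension of `K(G, n)` by `H₂(G, ℤ)`. -/
theorem exists_centralExtension_KTilde {X : Type*} {G : Type u} [Group G] {m : ℕ} (hm : 1 ≤ m)
    (p : FreeGroup X →* G) (hp : Function.Surjective p) :
    ∃ S : GroupExtension (Multiplicative (H2Z G)) (KTilde p (m + 1)) (K G (m + 1)),
      S.inl.range ≤ Subgroup.center (KTilde p (m + 1)) ∧
      ∀ x : K (FreeGroup X) (m + 1), S.rightHom (QuotientGroup.mk x) = KMap p (m + 1) x := by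
  obtain ⟨ψ, hψ, hψ₁⟩ := exists_hopf p hp
  have htp : ∀ a : FreeGroup X, tupleProd (Pi.mulSingle (Fin.last m) a : Fin (m + 1) → _) = a := by
    intro a
    rw [tupleProd_eq_init_mul]
    have : Fin.init (Pi.mulSingle (Fin.last m) a : Fin (m + 1) → FreeGroup X) =
        (1 : Fin m → FreeGroup X) := by
      funext i
      simp [Fin.init]
    rw [this]
    simp
  -- Placed in the last slot, an element of `N ∩ F'` is its own total product, so `ι` meets `KRel`
  -- exactly in `[N, F]`.
  let ι : (p.ker ⊓ commutator (FreeGroup X) : Subgroup _) →* K (FreeGroup X) (m + 1) :=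
    MonoidHom.mk' (fun a => ⟨Pi.mulSingle (Fin.last m) a.1, by rw [mem_K, htp]; exact a.2.2⟩) (by
      intro a b
      exact Subtype.ext (Pi.mulSingle_mul _ _ _))
  have hι₁ : ∀ a i, p ((ι a).1 i) = 1 := by
    intro a i
    change p ((Pi.mulSingle (Fin.last m) a.1 : Fin (m + 1) → FreeGroup X) i) = 1
    by_cases hi : i = Fin.last m
    · subst hi
      rw [Pi.mulSingle_eq_same]
      exact a.2.1
    · rw [Pi.mulSingle_eq_of_ne hi, map_one]
  have hι : ∀ a, ι a ∈ KRel p (m + 1) ↔ a.1 ∈ ⁅p.ker, (⊤ : Subgroup (FreeGroup X))⁆ := by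
    intro a
    rw [mem_KRel p hm]
    have h₂ : tupleProd (ι a).1 = a.1 := htp _
    rw [h₂]
    exact ⟨fun h => h.2, fun h => ⟨hι₁ a, h⟩⟩
  obtain ⟨inl, hinl⟩ := exists_factor ψ hψ ((QuotientGroup.mk' (KRel p (m + 1))).comp ι) (by
    intro a ha
    exact (QuotientGroup.eq_one_iff _).2 ((hι a).2 ((hψ₁ a).1 ha)))
  have hr : KRel p (m + 1) ≤ (KMap p (m + 1)).ker := by
    intro x hx
    rw [mem_KRel p hm] at hx
    exact Subtype.ext (funext hx.1)
  let rightHom : KTilde p (m + 1) →* K G (m + 1) := QuotientGroup.lift _ (KMap p (m + 1)) hr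
  have hker : ∀ x : K (FreeGroup X) (m + 1), (∀ i, p (x.1 i) = 1) →
      tupleProd x.1 ∈ p.ker ⊓ commutator (FreeGroup X) := by
    intro x hx
    refine ⟨?_, x.2⟩
    change p _ = 1
    rw [← tupleProd_powMap]
    exact (congrArg tupleProd (funext hx : powMap p (m + 1) x.1 = 1)).trans tupleProd_one
  have hrange : inl.range = rightHom.ker := by
    ext u
    constructor
    · rintro ⟨z, rfl⟩
      obtain ⟨a, rfl⟩ := hψ z
      rw [hinl, MonoidHom.mem_ker]
      apply Subtype.ext
      funext i
      exact hι₁ a i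
    · intro hu
      obtain ⟨x, rfl⟩ := QuotientGroup.mk_surjective u
      have hx : ∀ i, p (x.1 i) = 1 := fun i => congrFun (congrArg Subtype.val hu) i
      refine ⟨ψ ⟨_, hker x hx⟩, ?_⟩
      rw [hinl]
      refine KTilde_mk_eq p hm (fun i => ?_) (congrArg _ (htp _))
      rw [hx]
      exact hι₁ _ i
  refine ⟨⟨inl, rightHom, ?_, hrange, ?_⟩, ?_, fun x => rfl⟩
  · rw [injective_iff_map_eq_one]
    intro z hz
    obtain ⟨a, rfl⟩ := hψ z
    rw [hinl] at hz
    exact (hψ₁ a).2 ((hι a).1 ((QuotientGroup.eq_one_iff _).1 hz))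
  · rintro ⟨g, hg⟩
    choose s hs using hp
    have hg' : tupleProd g ∈ (commutator (FreeGroup X)).map p := by
      rw [map_commutator_eq_of_center p fun h => ⟨s h, by simp [hs, one_mem]⟩]
      exact hg
    obtain ⟨c, hc, hcg⟩ := hg'
    -- All entries but the last are lifted arbitrarily; the last is forced by the lift `c ∈ F'` of
    -- the total product, which keeps the tuple in `K(F, n)`.
    refine ⟨QuotientGroup.mk ⟨_, snoc_mem_K (fun i => s (g i.castSucc)) ⟨c, hc⟩⟩, ?_⟩
    apply Subtype.ext
    funext i
    change p ((Fin.snoc (fun i => s (g i.castSucc)) ((tupleProd fun i => s (g i.castSucc))⁻¹ * c) :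
      Fin (m + 1) → FreeGroup X) i) = g i
    induction i using Fin.lastCases with
    | cast i => simp [hs]
    | last =>
      rw [Fin.snoc_last, map_mul, map_inv, hcg, ← tupleProd_powMap, tupleProd_eq_init_mul g,
        inv_mul_eq_iff_eq_mul]
      congr 2
      funext i
      exact (hs _).symm
  · rintro _ ⟨z, rfl⟩
    obtain ⟨a, rfl⟩ := hψ z
    rw [hinl, Subgroup.mem_center_iff]
    intro u
    obtain ⟨x, rfl⟩ := QuotientGroup.mk_surjective u
    refine KTilde_mk_eq p hm (x := x * ι a) (y := ι a * x) (fun i => ?_) ?_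
    · change p (x.1 i * (ι a).1 i) = p ((ι a).1 i * x.1 i)
      rw [map_mul, map_mul, hι₁, mul_one, one_mul]
    · rw [← tupleProd_powMap, ← tupleProd_powMap]
      congr 1
      funext i
      change QuotientGroup.mk' _ (x.1 i * (ι a).1 i) = QuotientGroup.mk' _ ((ι a).1 i * x.1 i)
      rw [map_mul, map_mul]
      exact Subgroup.mem_center_iff.1 (mk_mem_center p (hι₁ a i)) _

end LiedtkeK

theorem mainTheorem12 {G : Type u} [Group G] [Finite G] (n : ℕ) (hn : 3 ≤ n) :
    -- a) `K(G, n) ≅ G^{n-1}.G'`, and the identity for `μ`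
    (LiedtkeK.IsoExplicitExtension (LiedtkeK.K G n) (Fin (n - 1) → G) (commutator G)
        LiedtkeK.mu LiedtkeK.tconj ∧
      ∀ (g h : Fin (n - 1) → G) (c : commutator G),
        LiedtkeK.mu g h * LiedtkeK.tconj (LiedtkeK.tconj c g) h =
          LiedtkeK.tconj c (g * h) * LiedtkeK.mu g h) ∧
    -- b) `K̃(G, n) ≅ G^{n-1}.(G ∧ G)`, for every Schur cover and every free presentation
    (∀ {H : Type v} [Group H] (π : H →* G), LiedtkeK.IsSchurCover π →
      -- the identification `G ∧ G = H'`, which respects the actions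
      ∃ θ : LiedtkeK.extSq G ≃* commutator H,
        (∀ x y : H, (θ (LiedtkeK.wedge (π x) (π y)) : H) = LiedtkeK.rcomm x y) ∧
        (∀ (c : LiedtkeK.extSq G) (x : H),
          θ (LiedtkeK.extAct c (π x)) = LiedtkeK.conjIn (commutator H) (θ c) x) ∧
        -- `γ(g, h) = μ(g', h')` for all lifts `g'`, `h'` of `g`, `h`
        ∃ γ : (Fin (n - 1) → G) → (Fin (n - 1) → G) → LiedtkeK.extSq G,
          (∀ g' h' : Fin (n - 1) → H,
            θ (γ (LiedtkeK.powMap π (n - 1) g') (LiedtkeK.powMap π (n - 1) h')) =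
              LiedtkeK.mu g' h') ∧
          ∀ {X : Type*} [Finite X] (p : FreeGroup X →* G), Function.Surjective p →
            LiedtkeK.IsoExplicitExtension (LiedtkeK.KTilde p n) (Fin (n - 1) → G)
              (LiedtkeK.extSq G) γ LiedtkeK.extTconj) ∧
    -- c) the central extension `1 → H₂(G, ℤ) → K̃(G, n) → K(G, n) → 1`
    (∀ {X : Type*} [Finite X] (p : FreeGroup X →* G), Function.Surjective p →
      ∃ S : GroupExtension (Multiplicative (LiedtkeK.H2Z G)) (LiedtkeK.KTilde p n)
          (LiedtkeK.K G n),
        S.inl.range ≤ Subgroup.center (LiedtkeK.KTilde p n) ∧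
        ∀ x : LiedtkeK.K (FreeGroup X) n,
          S.rightHom (QuotientGroup.mk x) = LiedtkeK.KMap p n x) := by
  obtain ⟨m, rfl⟩ : ∃ m, n = m + 1 := ⟨n - 1, by omega⟩
  have hm : 1 ≤ m := by omega
  refine ⟨⟨LiedtkeK.isoExplicitExtension_K m, LiedtkeK.mu_mul_tconj⟩, ?_, ?_⟩
  · intro H _ π h
    obtain ⟨θ, hθ, hact⟩ := h.exists_extSq_equiv
    choose s hs using h.surjective
    -- The cocycle is computed through a set-theoretic section `s` of `π`; since `mu` ignores
    -- central factors, any other lifts give the same value.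
    have hγ : ∀ g' h' : Fin m → H,
        LiedtkeK.mu (fun i => s (LiedtkeK.powMap π m g' i))
          (fun i => s (LiedtkeK.powMap π m h' i)) = LiedtkeK.mu g' h' := fun g' h' =>
      LiedtkeK.mu_eq_of_powMap_eq π h.ker_le_center (funext fun i => hs _) (funext fun i => hs _)
    have hγ' : ∀ g' h' : Fin m → H, θ (θ.symm (LiedtkeK.mu (fun i => s (LiedtkeK.powMap π m g' i))
          (fun i => s (LiedtkeK.powMap π m h' i)))) = LiedtkeK.mu g' h' := fun g' h' => by
      rw [θ.apply_symm_apply, hγ]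
    exact ⟨θ, hθ, hact, fun g h => θ.symm (LiedtkeK.mu (fun i => s (g i)) fun i => s (h i)), hγ',
      fun p hp => LiedtkeK.isoExplicitExtension_KTilde h θ hact hm _ hγ' p hp⟩
  · intro X _ p hp
    exact LiedtkeK.exists_centralExtension_KTilde hm p hp
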